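/- Let $M\ge 1$ and let $n>0$, $m>1$ be coprime integers with $m\mid M+2$. Put $a_{M+1}=0$, $a_{M+2}=1$, and let $a=(a_1,\dots,a_M)$ vary in $\mathcal D=(\mathbb C\setminus\{0,1\})^M\setminus\bigcup_{i\ne j}\{a_i=a_j\}$. For parameters $\theta=(\theta_1,\dots,\theta_{M+2},\theta_\infty)$ the Garnier system $\mathcal G_M(\theta)$ is the system $$\frac{\partial u_i}{\partial a_j}=\frac{\partial H_j}{\partial v_i},\qquad \frac{\partial v_i}{\partial a_j}=-\frac{\partial H_j}{\partial u_i},\qquad i,j=1,\dots,M,$$ $$H_j=-\frac{\Lambda(a_j)}{T'(a_j)}\sum_{k=1}^M\frac{T(u_k)}{(u_k-a_j)\Lambda'(u_k)}\Bigl[v_k^2-\sum_{l=1}^{M+2}\frac{\theta_l-\delta_{lj}}{u_k-a_l}\,v_k+\frac{\varkappa}{u_k(u_k-1)}\Bigr],$$ where $\Lambda(x)=\prod_{k=1}^M(x-u_k)$, $T(x)=\prod_{l=1}^{M+2}(x-a_l)$ and $\varkappa=\frac14\bigl((\sum_{l=1}^{M+2}\theta_l-1)^2-\theta_\infty^2\bigr)$.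 For $i=1,\dots,M+2$ define polynomials in $a_1,\dots,a_M$ by $$b_i(a)=\sum_{k_1+\dots+k_{M+2}+q=(M+2)n/m}(-1)^q\binom{n/m}{k_1}\cdots\binom{n/m}{k_{M+2}}\,a_1^{k_1}\cdots a_{M+2}^{k_{M+2}}\,a_i^{q}\qquad(0^0=1),$$ and put $$P_M(z,a)=\prod_{l=1}^{M+2}(z-a_l)\sum_{i=1}^{M+2}\frac{b_i(a)}{z-a_i}.$$ Then: 1. The matrices $B^{(i)}(a)=\begin{pmatrix}\frac{n}{2m}&b_i(a)\\0&-\frac{n}{2m}\end{pmatrix}$, $i=1,\dots,M+2$, satisfy on $\mathcal D$ the Schlesinger system in the variables $a_1,\dots,a_M$, that is, $\frac{\partial B^{(i)}}{\partial a_j}=\frac{[B^{(i)},B^{(j)}]}{a_i-a_j}$ for $i\neq j$ and $\frac{\partial B^{(j)}}{\partial a_j}=-\sum_{l\ne j}\frac{[B^{(j)},B^{(l)}]}{a_j-a_l}$, for $1\le j\le M$, $1\le i\le M+2$; moreover $\sum_{i=1}^{M+2}B^{(i)}=\mathrm{diag}\bigl(\frac{(M+2)n}{2m},-\frac{(M+2)n}{2m}\bigr)$.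 2. There is a non-zero polynomial $D\in\mathbb C[a_1,\dots,a_M]$ such that every $a^0\in\mathcal D$ with $D(a^0)\ne0$ has a neighbourhood in $\mathcal D$ on which the zeros of $P_M(\cdot,a)$, counted with multiplicity, are given by $M$ continuous functions $u_1,\dots,u_M$ whose values at each $a$ are pairwise distinct and different from $a_1,\dots,a_{M+2}$. 3. Whenever $U\subset\mathcal D$ is open and $u_1,\dots,u_M$ are such functions on $U$, then for every $\varepsilon\in\{\pm1\}^{M+2}$ the functions $u_j$ together with $$v_j^{\varepsilon}(a)=\sum_{i=1}^{M+2}\frac{(1+\varepsilon_i)\,n/(2m)}{u_j(a)-a_i},\qquad j=1,\dots,M,$$ are holomorphic on $U$, algebraic over $\mathbb C(a_1,\dots,a_M)$, and $(u_1,\dots,u_M,v_1^{\varepsilon},\dots,v_M^{\varepsilon})$ solves the Garnier system $\mathcal G_M(\theta)$ with $$\theta=\Bigl(\varepsilon_1\frac nm,\dots,\varepsilon_{M+2}\frac nm,\,-\frac{(M+2)n}m-1\Bigr).$$ In particular, for every choice of the signs, $\mathcal G_M\bigl(\pm\frac nm,\dots,\pm\frac nm,-\frac{(M+2)n}m-1\bigr)$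 possesses an algebraic solution, which is given explicitly. -/

import Mathlib

noncomputable section

namespace Garnier

/-- The `M + 2` finite singular points `a_1, …, a_M, a_{M+1} = 0, a_{M+2} = 1`, over any
commutative ring. -/
def node {R : Type*} [CommRing R] {M : ℕ} (a : Fin M → R) : Fin (M + 2) → R :=
  Fin.append a ![0, 1]

/-- The space `(ℂ ∖ {0, 1})^M ∖ ⋃_{i ≠ j} {a_i = a_j}`. -/
def config (M : ℕ) : Set (Fin M → ℂ) := {a | Function.Injective (node a)}

/-- The partial derivative `∂f/∂x_j` at `x`. -/
def pd {M : ℕ} (f : (Fin M → ℂ) → ℂ) (j : Fin M) (x : Fin M → ℂ) : ℂ :=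
  deriv (fun s => f (Function.update x j s)) (x j)

/-! ### The Schlesinger system -/

/-- `B^{(1)}, …, B^{(M+2)}` are holomorphic on `U` and solve the Schlesinger system in the
variables `a_1, …, a_M` (with `a_{M+1} = 0`, `a_{M+2} = 1` fixed):
`∂B^{(i)}/∂a_j = [B^{(i)}, B^{(j)}] / (a_i - a_j)` for `i ≠ j`, and
`∂B^{(j)}/∂a_j = - ∑_{l ≠ j} [B^{(j)}, B^{(l)}] / (a_j - a_l)`. -/
def IsSchlesingerSolution {M : ℕ} (U : Set (Fin M → ℂ))
    (B : Fin (M + 2) → (Fin M → ℂ) → Matrix (Fin 2) (Fin 2) ℂ) : Prop :=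
  (∀ i r c, DifferentiableOn ℂ (fun a => B i a r c) U) ∧
  ∀ a ∈ U, ∀ j : Fin M,
    (∀ i : Fin (M + 2), i ≠ Fin.castAdd 2 j → ∀ r c,
      pd (fun x => B i x r c) j a =
        (B i a * B (Fin.castAdd 2 j) a - B (Fin.castAdd 2 j) a * B i a) r c
          / (node a i - a j)) ∧
    (∀ r c,
      pd (fun x => B (Fin.castAdd 2 j) x r c) j a =
        - ∑ l ∈ Finset.univ.erase (Fin.castAdd 2 j),
            (B (Fin.castAdd 2 j) a * B l a - B l a * B (Fin.castAdd 2 j) a) r c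
              / (a j - node a l))

/-- The polynomial `b_i ∈ ℂ[a_1, …, a_M]`,
`b_i = ∑ (-1)^q (n/m choose k_1) ⋯ (n/m choose k_{M+2}) a_1^{k_1} ⋯ a_{M+2}^{k_{M+2}} a_i^q`,
the sum being over `k_1 + ⋯ + k_{M+2} + q = ((M+2)/m) n`, where `a_{M+1} = 0`, `a_{M+2} = 1`
and `0^0 = 1` (so that only `k_{M+1} = 0` contributes). -/
def b (M n m : ℕ) (i : Fin (M + 2)) : MvPolynomial (Fin M) ℂ :=
  ∑ p ∈ Finset.HasAntidiagonal.antidiagonal ((M + 2) / m * n),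
    ∑ k ∈ Finset.piAntidiag (Finset.univ : Finset (Fin (M + 2))) p.1,
      (-1) ^ p.2
        * (∏ l, MvPolynomial.C (Ring.choose ((n : ℂ) / m) (k l))
            * node (MvPolynomial.X (R := ℂ) : Fin M → MvPolynomial (Fin M) ℂ) l ^ k l)
        * node (MvPolynomial.X (R := ℂ) : Fin M → MvPolynomial (Fin M) ℂ) i ^ p.2

/-- The triangular traceless matrix `B^{(i)}(a)` with diagonal `± n/(2m)` and upper right
entry `b_i(a)`. -/
def B (M n m : ℕ) (i : Fin (M + 2)) (a : Fin M → ℂ) : Matrix (Fin 2) (Fin 2) ℂ :=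
  !![(n : ℂ) / (2 * m), MvPolynomial.eval a (b M n m i); 0, -((n : ℂ) / (2 * m))]

/-- `P_M(z, a) = (z - a_1) ⋯ (z - a_{M+2}) ∑_i b_i(a) / (z - a_i)`, for fixed `a`, as a
polynomial in `z`. -/
def P (M n m : ℕ) (a : Fin M → ℂ) : Polynomial ℂ :=
  ∑ i, Polynomial.C (MvPolynomial.eval a (b M n m i))
    * ∏ l ∈ Finset.univ.erase i, (Polynomial.X - Polynomial.C (node a l))

/-! ### The Garnier system -/

/-- `T(x) = (x - a_1) ⋯ (x - a_{M+2})`. -/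
def T {M : ℕ} (a : Fin M → ℂ) : Polynomial ℂ :=
  ∏ l, (Polynomial.X - Polynomial.C (node a l))

/-- `Λ(x) = (x - u_1) ⋯ (x - u_M)`. -/
def Lam {M : ℕ} (u : Fin M → ℂ) : Polynomial ℂ :=
  ∏ l, (Polynomial.X - Polynomial.C (u l))

/-- `κ = ((θ_1 + ⋯ + θ_{M+2} - 1)^2 - θ_∞^2) / 4`. -/
def kappa {M : ℕ} (θ : Fin (M + 2) → ℂ) (θinf : ℂ) : ℂ :=
  ((∑ l, θ l - 1) ^ 2 - θinf ^ 2) / 4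

/-- Okamoto's Hamiltonian
`H_j = - Λ(a_j)/T'(a_j) ∑_k T(u_k) / ((u_k - a_j) Λ'(u_k)) *
  [v_k^2 - (∑_l (θ_l - δ_{lj}) / (u_k - a_l)) v_k + κ / (u_k (u_k - 1))]`. -/
def H {M : ℕ} (θ : Fin (M + 2) → ℂ) (θinf : ℂ) (j : Fin M) (a u v : Fin M → ℂ) : ℂ :=
  -((Lam u).eval (a j) / (T a).derivative.eval (a j)) *
    ∑ k, (T a).eval (u k) / ((u k - a j) * (Lam u).derivative.eval (u k)) *
      (v k ^ 2
        - (∑ l, (θ l - if l = Fin.castAdd 2 j then 1 else 0) / (u k - node a l)) * v k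
        + kappa θ θinf / (u k * (u k - 1)))

/-- `(u, v)` is a holomorphic solution on `U` of the Garnier system `G_M(θ)`:
`∂u_i/∂a_j = ∂H_j/∂v_i`, `∂v_i/∂a_j = - ∂H_j/∂u_i`. Along a solution the Hamiltonians are
required to be regular: the `a_i` (including `0` and `1`) are pairwise distinct, the `u_j`
are pairwise distinct, and no `u_j` equals an `a_i`. -/
def IsGarnierSolution {M : ℕ} (θ : Fin (M + 2) → ℂ) (θinf : ℂ) (U : Set (Fin M → ℂ))
    (u v : (Fin M → ℂ) → Fin M → ℂ) : Prop :=
  DifferentiableOn ℂ u U ∧ DifferentiableOn ℂ v U ∧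
  ∀ a ∈ U,
    a ∈ config M ∧ Function.Injective (u a) ∧ (∀ j l, u a j ≠ node a l) ∧
    ∀ i j,
      pd (fun x => u x i) j a = pd (fun y => H θ θinf j a (u a) y) i (v a) ∧
      pd (fun x => v x i) j a = - pd (fun y => H θ θinf j a y (v a)) i (u a)

/-- The function `f` is algebraic on `U`: `Q(a, f(a)) = 0` on `U` for some non-zero polynomial
`Q ∈ ℂ[a_1, …, a_M][y]`. -/
def IsAlgebraicOn {M : ℕ} (U : Set (Fin M → ℂ)) (f : (Fin M → ℂ) → ℂ) : Prop :=
  ∃ Q : Polynomial (MvPolynomial (Fin M) ℂ), Q ≠ 0 ∧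
    ∀ a ∈ U, (Q.map (MvPolynomial.eval a)).eval (f a) = 0

/-- An algebraic solution: a solution all components of which are algebraic functions. -/
def IsAlgebraicGarnierSolution {M : ℕ} (θ : Fin (M + 2) → ℂ) (θinf : ℂ)
    (U : Set (Fin M → ℂ)) (u v : (Fin M → ℂ) → Fin M → ℂ) : Prop :=
  IsGarnierSolution θ θinf U u v ∧
  ∀ j, IsAlgebraicOn U (fun a => u a j) ∧ IsAlgebraicOn U (fun a => v a j)

/-- `u = (u_1, …, u_M)` is a continuous choice on `U` of the zeros of `P_M(z, a)`, counted with
multiplicity, where the `a_i` are pairwise distinct, the zeros are simple and none of them is one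
of the `a_i`. -/
def IsZeroBranch (M n m : ℕ) (U : Set (Fin M → ℂ)) (u : (Fin M → ℂ) → Fin M → ℂ) : Prop :=
  ContinuousOn u U ∧
  ∀ a ∈ U,
    a ∈ config M ∧ P M n m a ≠ 0 ∧
    (P M n m a).roots = (Finset.univ : Finset (Fin M)).val.map (u a) ∧
    Function.Injective (u a) ∧ ∀ j l, u a j ≠ node a l

/-- `v_j^ε(a) = ∑_i (1 + ε_i) (n/(2m)) / (u_j(a) - a_i)`. -/
def vEps {M : ℕ} (n m : ℕ) (ε : Fin (M + 2) → ℤˣ) (u : (Fin M → ℂ) → Fin M → ℂ) :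
    (Fin M → ℂ) → Fin M → ℂ :=
  fun a j => ∑ i, (1 + ((ε i : ℤ) : ℂ)) * ((n : ℂ) / (2 * m)) / (u a j - node a i)

/-- The parameters `θ_i = ε_i n/m`, `i = 1, …, M+2`. -/
def theta {M : ℕ} (n m : ℕ) (ε : Fin (M + 2) → ℤˣ) : Fin (M + 2) → ℂ :=
  fun i => ((ε i : ℤ) : ℂ) * ((n : ℂ) / m)

/-- The parameter `θ_∞ = -(M+2) n/m - 1`. -/
def thetaInf (M n m : ℕ) : ℂ := -(((M : ℂ) + 2) * n / m) - 1

end Garnier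

end

/-! Put `c = n/m`, `N = M + 2`, `d = N c` and `G(t) = ∏ (1 + a_l t)^c`. The polynomial `b_i` is the
coefficient of `t^d` in `G / (1 + a_i t)`.

Schlesinger system. The matrices are upper triangular with a common diagonal, so `[B^(i), B^(j)]`
has the single entry `c (b_j - b_i)`, and the system reduces to `∂_j b_i = c (b_j - b_i) / (a_i -
a_j)` for `i ≠ j` together with `∑ b_i = 0`. The first follows from `∂_j G = c t G / (1 + a_j t)`
and partial fractions in `t` (`derivation_bCoeff`). The second is the coefficient of `t^d` in `t G'
= c (N G - ∑ G / (1 + a_i t))`, where `d = N c` kills the `G` term (`sum_bCoeff`).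

Garnier system. Let `S` be the set of indices with `ε = 1` and `V(x) = ∑_{l ∈ S} c / (x - a_l)`, so
that `v_k = V(u_k)`. Substituting `v = V(u)`, the bracket of `H_j` times `(x - a_j) T(x)` is a
polynomial `Γ`, and the value of `κ` is exactly what lowers its degree from `M + 1` to `M`. The
residue theorem for `Γ / ((x - a_j)^2 Λ)` then gives `H_j(u, V(u)) = K(a) + w_j ∑ 1 / (u_k - a_j)`,
with `w_j = c` or `0` as `j ∈ S` or not (`exists_H_eq`). Differentiating this in `u_i` expresses
`∂H_j/∂u_i` through `∂H_j/∂v_i`, and the equation for `v_i` becomes the chain rule applied to the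
one for `u_i`. The equation for `u_i` comes from differentiating `∑ b_l / (u_i - a_l) = 0` and using
the Schlesinger equations and `P_M = λ Λ` (`IsZeroBranch.pd_eq`); it does not involve `ε`.

Genericity. `D` is a discriminant-type resultant times the coefficient of `z^M` times `∏ b_i`. It is
nonzero because along `a = e x`, with `x` the `M`-th roots of unity and `e → 0`, the rescaled zeros
of `P_M` tend to those of `(M + 1) ζ^M - 1`, which are simple
(`exists_natDegree_P_eq_and_separable`). Coprimality enters here: `c` is not a natural number, so
`b_i(0) ≠ 0`. -/

noncomputable section

namespace Garnier

section

/-! ### Generating series for the coefficients `b_i` -/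

section GeneratingSeries

open PowerSeries

variable {A : Type*} [CommRing A]

/-- The geometric series `(1 + x t)⁻¹`. -/
def geom (x : A) : A⟦X⟧ := PowerSeries.mk fun q => (-1) ^ q * x ^ q

theorem one_add_mul_geom (x : A) : (1 + C x * X) * geom x = 1 := by
  ext n
  rcases n with _ | n
  · simp [geom, add_mul, mul_assoc]
  · simp only [geom, add_mul, one_mul, mul_assoc, map_add, coeff_C_mul, coeff_succ_X_mul,
      coeff_mk, coeff_one]
    rw [if_neg (by lia)]
    ring

/-- Partial fractions in `t`; this produces the difference quotient in the Schlesinger equations. -/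
theorem sub_mul_geom_mul_geom (x y : A) :
    C (x - y) * X * geom x * geom y = geom y - geom x := by
  rw [map_sub]
  linear_combination geom y * one_add_mul_geom x - geom x * one_add_mul_geom y

variable [Algebra ℂ A]

/-- The binomial series `(1 + x t) ^ c`. -/
def binom (c : ℂ) (x : A) : A⟦X⟧ :=
  PowerSeries.mk fun k => algebraMap ℂ A (Ring.choose c k) * x ^ k

theorem succ_mul_choose_succ (c : ℂ) (k : ℕ) :
    ((k : ℂ) + 1) * Ring.choose c (k + 1) = (c - k) * Ring.choose c k := by
  rw [Ring.choose_eq_smul, Ring.choose_eq_smul, descPochhammer_succ_right]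
  have h1 : ((k + 1).factorial : ℂ) ≠ 0 := by exact_mod_cast (k + 1).factorial_ne_zero
  have h2 : (k.factorial : ℂ) ≠ 0 := by exact_mod_cast k.factorial_ne_zero
  simp only [Polynomial.smeval_mul, Polynomial.smeval_sub, Polynomial.smeval_X, pow_one,
    Polynomial.smeval_natCast, smul_eq_mul, nsmul_eq_mul, pow_zero, mul_one]
  rw [Nat.factorial_succ] at *
  push_cast at *
  have h3 : (k : ℂ) + 1 ≠ 0 := left_ne_zero_of_mul h1
  field_simp

/-- The factor `c - k` in the recursion never vanishes. -/
theorem choose_ne_zero {c : ℂ} (hc : ∀ k : ℕ, c ≠ k) (k : ℕ) : Ring.choose c k ≠ 0 := by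
  induction k with
  | zero => simp
  | succ k ih =>
    intro h
    have := succ_mul_choose_succ c k
    rw [h, mul_zero, eq_comm] at this
    exact mul_ne_zero (sub_ne_zero.mpr (hc k)) ih this

theorem algebraMap_choose_succ (c : ℂ) (k : ℕ) :
    algebraMap ℂ A (Ring.choose c (k + 1)) * ((k : A) + 1) =
      (algebraMap ℂ A c - k) * algebraMap ℂ A (Ring.choose c k) := by
  have := congrArg (algebraMap ℂ A) (succ_mul_choose_succ c k)
  simpa [mul_comm] using this

/-- The differential equation of `(1 + x t)^c`; coefficientwise it is the recursion for binomial
coefficients. -/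
theorem one_add_mul_derivative_binom (c : ℂ) (x : A) :
    (1 + C x * X) * d⁄dX A (binom c x) = C (algebraMap ℂ A c * x) * binom c x := by
  ext n
  rcases n with _ | n
  · have h0 : coeff 0 (d⁄dX A (binom c x)) = algebraMap ℂ A c * x := by
      rw [coeff_derivative]
      simp [binom]
    rw [coeff_C_mul, add_mul, one_mul, map_add, h0, mul_assoc, coeff_C_mul, coeff_zero_X_mul]
    simp [binom]
  · have h := algebraMap_choose_succ (A := A) c (n + 1)
    simp only [binom, add_mul, one_mul, mul_assoc, map_add, coeff_C_mul, coeff_succ_X_mul,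
      coeff_derivative, coeff_mk] at h ⊢
    push_cast at h ⊢
    linear_combination x ^ (n + 1 + 1) * h

theorem derivative_binom (c : ℂ) (x : A) :
    d⁄dX A (binom c x) = C (algebraMap ℂ A c * x) * geom x * binom c x := by
  linear_combination geom x * one_add_mul_derivative_binom c x
    - d⁄dX A (binom c x) * one_add_mul_geom x

/-- A derivation of the coefficients, acting on power series coefficientwise. -/
def coeffDerivation (D : Derivation ℂ A A) : Derivation ℂ A⟦X⟧ A⟦X⟧ :=
  Derivation.mk'
    { toFun := fun f => PowerSeries.mk fun n => D (coeff n f)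
      map_add' := fun f g => by ext n; simp
      map_smul' := fun r f => by ext n; simp }
    fun f g => by
      ext n
      simp only [LinearMap.coe_mk, AddHom.coe_mk, coeff_mk, coeff_mul, map_sum,
        Derivation.leibniz, smul_eq_mul, map_add, Finset.sum_add_distrib]
      congr 1
      exact Finset.Nat.sum_antidiagonal_swap (f := fun x => coeff x.1 g * D (coeff x.2 f))

theorem coeff_coeffDerivation (D : Derivation ℂ A A) (f : A⟦X⟧) (n : ℕ) :
    coeff n (coeffDerivation D f) = D (coeff n f) := by
  simp [coeffDerivation]

/-- Logarithmic derivatives add; the multiplicative form avoids dividing by the factors. -/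
theorem derivation_prod_of_log {R S ι : Type*} [CommRing R] [CommRing S] [Algebra R S]
    (D : Derivation R S S) (s : Finset ι) (F g : ι → S) (h : ∀ l ∈ s, D (F l) = g l * F l) :
    D (∏ l ∈ s, F l) = (∑ l ∈ s, g l) * ∏ l ∈ s, F l := by
  classical
  induction s using Finset.induction_on with
  | empty => simp
  | insert l s hl ih =>
    rw [Finset.prod_insert hl, Finset.sum_insert hl, Derivation.leibniz, h l (by simp),
      ih fun k hk => h k (by simp [hk])]
    simp only [smul_eq_mul]
    ring

theorem coeffDerivation_binom (D : Derivation ℂ A A) (c : ℂ) (x : A) :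
    coeffDerivation D (binom c x) =
      C (algebraMap ℂ A c * D x) * X * geom x * binom c x := by
  have h : (1 + C x * X) * coeffDerivation D (binom c x) =
      C (algebraMap ℂ A c * D x) * X * binom c x := by
    ext n
    rcases n with _ | n
    · rw [add_mul, one_mul, map_add, coeff_coeffDerivation, mul_assoc, mul_assoc, coeff_C_mul,
        coeff_C_mul, coeff_zero_X_mul, coeff_zero_X_mul]
      simp [binom]
    · have h := algebraMap_choose_succ (A := A) c n
      simp only [add_mul, one_mul, mul_assoc, map_add, coeff_C_mul, coeff_succ_X_mul,
        coeff_coeffDerivation, binom, coeff_mk, Derivation.leibniz, Derivation.leibniz_pow,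
        Derivation.map_algebraMap, smul_eq_mul, nsmul_eq_mul]
      -- The derivative of `x ^ n` carries the truncated exponent `n - 1`, so `n = 0` is separate.
      rcases n with _ | n
      · simp
      · simp only [Nat.add_sub_cancel]
        push_cast at h ⊢
        linear_combination D x * x ^ (n + 1) * h
  linear_combination geom x * h - coeffDerivation D (binom c x) * one_add_mul_geom x

theorem coeffDerivation_geom (D : Derivation ℂ A A) {x : A} (hx : D x = 0) :
    coeffDerivation D (geom x) = 0 := by
  ext n
  have : D ((-1) ^ n * x ^ n) = 0 := by
    rw [← mul_pow, Derivation.leibniz_pow]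
    simp [hx]
  simpa [coeff_coeffDerivation, geom] using this

/-- The coefficient of `t ^ d` in `∏ (1 + x_l t) ^ c / (1 + x_i t)`. -/
def bCoeff {ι : Type*} [Fintype ι] (c : ℂ) (d : ℕ) (x : ι → A) (i : ι) : A :=
  coeff d ((∏ l, binom c (x l)) * geom (x i))

/-- Apply `t d/dt` to `G`: since `c x t / (1 + x t) = c (1 - 1 / (1 + x t))`, one gets `t G' = c (N
G - ∑ G / (1 + x_i t))`. In degree `d = N c` the terms in `G` cancel. -/
theorem sum_bCoeff {ι : Type*} [Fintype ι] {c : ℂ} {d : ℕ} (hc : c ≠ 0)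
    (hd : (d : ℂ) = Fintype.card ι * c) (x : ι → A) : ∑ i, bCoeff c d x i = 0 := by
  set G : A⟦X⟧ := ∏ l, binom c (x l) with hG
  have h := derivation_prod_of_log (d⁄dX A) Finset.univ (fun l => binom c (x l)) _
    fun l _ => derivative_binom c (x l)
  rw [← hG] at h
  have h2 : X * d⁄dX A G = C (algebraMap ℂ A c) * ((Fintype.card ι : A⟦X⟧) * G
      - ∑ i, G * geom (x i)) := by
    have h3 : ∀ i, X * (C (algebraMap ℂ A c * x i) * geom (x i)) =
        C (algebraMap ℂ A c) * (1 - geom (x i)) := by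
      intro i
      rw [map_mul]
      linear_combination C (algebraMap ℂ A c) * one_add_mul_geom (x i)
    rw [h, ← mul_assoc, Finset.mul_sum, Finset.sum_congr rfl fun i _ => h3 i, ← Finset.mul_sum,
      Finset.sum_sub_distrib, ← Finset.mul_sum]
    simp
    ring
  have h4 := congrArg (coeff d) h2
  have h5 : coeff d (X * d⁄dX A G) = (d : A) * coeff d G := by
    rcases d with _ | d
    · simp
    · rw [coeff_succ_X_mul, coeff_derivative]
      push_cast
      ring
  have h6 : (d : A) = Fintype.card ι * algebraMap ℂ A c := by
    have := congrArg (algebraMap ℂ A) hd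
    simpa using this
  rw [h5, coeff_C_mul, map_sub, map_sum, ← map_natCast (C (R := A)), coeff_C_mul, h6] at h4
  have h7 : algebraMap ℂ A c * ∑ i, bCoeff c d x i = 0 := by
    unfold bCoeff
    rw [← hG]
    linear_combination h4
  -- `A` may have zero divisors, but the image of `c` is a unit.
  have h8 := congrArg (algebraMap ℂ A c⁻¹ * ·) h7
  simpa [← mul_assoc, ← map_mul, hc] using h8

/-- Only the factor with `l = j` contributes to `D G = c t G / (1 + x_j t)`, and `1 / (1 + x_i t)`
is constant for `D` because `i ≠ j`. Partial fractions finish. -/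
theorem derivation_bCoeff {ι : Type*} [Fintype ι] [DecidableEq ι] (c : ℂ) (d : ℕ) (x : ι → A)
    (D : Derivation ℂ A A) {i j : ι} (hij : i ≠ j) (hD : ∀ l, D (x l) = if l = j then 1 else 0) :
    (x i - x j) * D (bCoeff c d x i) =
      algebraMap ℂ A c * (bCoeff c d x j - bCoeff c d x i) := by
  set G : A⟦X⟧ := ∏ l, binom c (x l) with hG
  have h := derivation_prod_of_log (coeffDerivation D) Finset.univ (fun l => binom c (x l)) _
    fun l _ => coeffDerivation_binom D c (x l)
  rw [← hG] at h
  simp only [hD, mul_ite, mul_one, mul_zero, apply_ite (C (R := A)), map_zero, ite_mul, zero_mul,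
    Finset.sum_ite_eq', Finset.mem_univ, if_true] at h
  have h2 : C (x i - x j) * coeffDerivation D (G * geom (x i)) =
      C (algebraMap ℂ A c) * (G * geom (x j) - G * geom (x i)) := by
    rw [Derivation.leibniz, coeffDerivation_geom D (by simp [hD, hij]), h]
    simp only [smul_eq_mul]
    linear_combination C (algebraMap ℂ A c) * G * sub_mul_geom_mul_geom (x i) (x j)
  have h3 := congrArg (coeff d) h2
  rwa [coeff_C_mul, coeff_C_mul, coeff_coeffDerivation, map_sub] at h3

theorem map_bCoeff {B ι : Type*} [CommRing B] [Algebra ℂ B] [Fintype ι] (f : A →ₐ[ℂ] B)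
    (c : ℂ) (d : ℕ) (x : ι → A) (i : ι) :
    f (bCoeff c d x i) = bCoeff c d (fun l => f (x l)) i := by
  have h1 : ∀ y : A, PowerSeries.map (f : A →+* B) (binom c y) = binom c (f y) := by
    intro y; ext n; simp [binom]
  have h2 : ∀ y : A, PowerSeries.map (f : A →+* B) (geom y) = geom (f y) := by
    intro y; ext n; simp [geom]
  have : f (bCoeff c d x i) = (f : A →+* B) (bCoeff c d x i) := rfl
  rw [this, bCoeff, ← coeff_map, map_mul, map_prod, h2, Finset.prod_congr rfl fun l _ => h1 (x l),
    bCoeff]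

end GeneratingSeries

theorem b_eq_bCoeff (M n m : ℕ) (i : Fin (M + 2)) :
    b M n m i = bCoeff ((n : ℂ) / m) ((M + 2) / m * n)
      (node (MvPolynomial.X (R := ℂ) : Fin M → MvPolynomial (Fin M) ℂ)) i := by
  rw [b, bCoeff, PowerSeries.coeff_mul]
  refine Finset.sum_congr rfl fun p _ => ?_
  rw [PowerSeries.coeff_prod, Finset.sum_mul]
  refine Finset.sum_bij' (fun k _ => Finsupp.equivFunOnFinite.symm k)
    (fun k _ => (k : Fin (M + 2) → ℕ)) ?_ ?_ ?_ ?_ ?_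
  · intro k hk
    simpa [Finset.mem_finsuppAntidiag, Finset.mem_piAntidiag] using hk
  · intro k hk
    simpa [Finset.mem_finsuppAntidiag, Finset.mem_piAntidiag] using hk
  · intro k _; rfl
  · intro k _; ext; rfl
  · intro k _
    simp only [binom, geom, PowerSeries.coeff_mk, MvPolynomial.algebraMap_eq,
      Finsupp.coe_equivFunOnFinite_symm]
    ring

end

section

/-! ### The residues `b_i(a)` and the Schlesinger system -/

variable {M : ℕ}

@[simp]
theorem node_castAdd {R : Type*} [CommRing R] (a : Fin M → R) (j : Fin M) :
    node a (Fin.castAdd 2 j) = a j := by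
  simp [node]

theorem node_natAdd {R : Type*} [CommRing R] (a : Fin M → R) (k : Fin 2) :
    node a (Fin.natAdd M k) = ![0, 1] k := by
  simp [node]

theorem map_node {R S : Type*} [CommRing R] [CommRing S] (f : R →+* S) (a : Fin M → R)
    (l : Fin (M + 2)) : f (node a l) = node (fun i => f (a i)) l := by
  refine Fin.addCases (fun i => ?_) (fun k => ?_) l
  · simp
  · rw [node_natAdd, node_natAdd]
    fin_cases k <;> simp

theorem node_update (a : Fin M → ℂ) (j : Fin M) (s : ℂ) (l : Fin (M + 2)) :
    node (Function.update a j s) l = if l = Fin.castAdd 2 j then s else node a l := by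
  refine Fin.addCases (fun i => ?_) (fun k => ?_) l
  · by_cases h : i = j
    · subst h; simp
    · simp [h]
  · rw [node_natAdd, node_natAdd, if_neg]
    intro h
    have := congrArg Fin.val h
    simp only [Fin.val_natAdd, Fin.val_castAdd] at this
    lia

theorem pderiv_node_X (j : Fin M) (l : Fin (M + 2)) :
    MvPolynomial.pderiv j
      (node (MvPolynomial.X (R := ℂ) : Fin M → MvPolynomial (Fin M) ℂ) l) =
      if l = Fin.castAdd 2 j then 1 else 0 := by
  refine Fin.addCases (fun i => ?_) (fun k => ?_) l
  · rw [node_castAdd, MvPolynomial.pderiv_X]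
    simp [Pi.single_apply, eq_comm]
  · rw [node_natAdd, if_neg]
    · fin_cases k <;> simp
    · intro h
      have := congrArg Fin.val h
      simp only [Fin.val_natAdd, Fin.val_castAdd] at this
      lia

theorem contDiff_node {k : WithTop ℕ∞} (l : Fin (M + 2)) :
    ContDiff ℂ k fun a : Fin M → ℂ => node a l := by
  refine Fin.addCases (fun i => ?_) (fun k => ?_) l
  · simp only [node_castAdd]
    exact contDiff_apply ℂ ℂ i
  · simp only [node_natAdd]
    exact contDiff_const

/-- The bridge from the formal derivation `pderiv` to the analytic derivative `pd`. -/
theorem hasDerivAt_eval_update (p : MvPolynomial (Fin M) ℂ) (a : Fin M → ℂ) (j : Fin M) :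
    HasDerivAt (fun s => MvPolynomial.eval (Function.update a j s) p)
      (MvPolynomial.eval a (MvPolynomial.pderiv j p)) (a j) := by
  induction p using MvPolynomial.induction_on with
  | C r => simpa using hasDerivAt_const (a j) r
  | add p q hp hq =>
    simp only [map_add]
    exact hp.add hq
  | mul_X p i hp =>
    have hX : HasDerivAt (fun s => Function.update a j s i) (if i = j then 1 else 0) (a j) := by
      by_cases h : i = j
      · subst h
        simpa using hasDerivAt_id' (a i)
      · simpa [h] using hasDerivAt_const (a j) (a i)
    have := hp.mul hX
    simp only [map_mul, MvPolynomial.eval_X, Derivation.leibniz, smul_eq_mul, map_add,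
      MvPolynomial.pderiv_X]
    refine this.congr_deriv ?_
    by_cases h : i = j
    · subst h
      simp
      ring
    · simp [h]
      ring

theorem contDiff_eval {k : WithTop ℕ∞} (p : MvPolynomial (Fin M) ℂ) :
    ContDiff ℂ k fun a : Fin M → ℂ => MvPolynomial.eval a p := by
  induction p using MvPolynomial.induction_on with
  | C r =>
    simp only [MvPolynomial.eval_C]
    exact contDiff_const
  | add p q hp hq =>
    simp only [map_add]
    exact hp.add hq
  | mul_X p i hp =>
    simp only [map_mul, MvPolynomial.eval_X]
    exact hp.mul (contDiff_apply ℂ ℂ i)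

variable {n m : ℕ}

/-- Divisibility makes the division in `ℕ` exact, so the degree meets the hypothesis `hd` of
`sum_bCoeff`. -/
theorem natCast_div_mul (hm : 1 < m) (hdvd : m ∣ M + 2) :
    (((M + 2) / m * n : ℕ) : ℂ) = ((M : ℂ) + 2) * ((n : ℂ) / m) := by
  have hm0 : (m : ℂ) ≠ 0 := by exact_mod_cast (by lia : m ≠ 0)
  rw [Nat.cast_mul, Nat.cast_div hdvd hm0]
  push_cast
  field_simp

theorem sum_b (hn : 0 < n) (hm : 1 < m) (hdvd : m ∣ M + 2) : ∑ i, b M n m i = 0 := by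
  have hm0 : (m : ℂ) ≠ 0 := by exact_mod_cast (by lia : m ≠ 0)
  have hn0 : (n : ℂ) ≠ 0 := by exact_mod_cast hn.ne'
  simp_rw [b_eq_bCoeff]
  refine sum_bCoeff (div_ne_zero hn0 hm0) ?_ _
  rw [natCast_div_mul hm hdvd]
  simp

theorem sum_eval_b (hn : 0 < n) (hm : 1 < m) (hdvd : m ∣ M + 2) (a : Fin M → ℂ) :
    ∑ i, MvPolynomial.eval a (b M n m i) = 0 := by
  rw [← map_sum, sum_b hn hm hdvd, map_zero]

theorem eval_pderiv_b_of_ne {a : Fin M → ℂ} (ha : a ∈ config M) {i : Fin (M + 2)} {j : Fin M}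
    (hij : i ≠ Fin.castAdd 2 j) :
    MvPolynomial.eval a (MvPolynomial.pderiv j (b M n m i)) =
      (n : ℂ) / m * (MvPolynomial.eval a (b M n m (Fin.castAdd 2 j))
        - MvPolynomial.eval a (b M n m i)) / (node a i - a j) := by
  have h := derivation_bCoeff ((n : ℂ) / m) ((M + 2) / m * n)
    (node (MvPolynomial.X (R := ℂ) : Fin M → MvPolynomial (Fin M) ℂ)) (MvPolynomial.pderiv j)
    hij (pderiv_node_X j)
  rw [← b_eq_bCoeff, ← b_eq_bCoeff] at h
  have h2 := congrArg (MvPolynomial.eval a) h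
  have hne : node a i - a j ≠ 0 := by
    rw [sub_ne_zero, ← node_castAdd a j]
    exact fun h => hij (ha h)
  rw [eq_div_iff hne]
  simpa [map_node, mul_comm] using h2

theorem eval_pderiv_b_self (hn : 0 < n) (hm : 1 < m) (hdvd : m ∣ M + 2) (a : Fin M → ℂ)
    (j : Fin M) :
    MvPolynomial.eval a (MvPolynomial.pderiv j (b M n m (Fin.castAdd 2 j))) =
      -∑ l ∈ Finset.univ.erase (Fin.castAdd 2 j),
        MvPolynomial.eval a (MvPolynomial.pderiv j (b M n m l)) := by
  have h := congrArg (fun p => MvPolynomial.eval a (MvPolynomial.pderiv j p))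
    (sum_b (M := M) hn hm hdvd)
  simp only [map_sum, map_zero] at h
  rw [← Finset.add_sum_erase _ _ (Finset.mem_univ (Fin.castAdd 2 j))] at h
  exact eq_neg_of_add_eq_zero_left h

theorem isSchlesingerSolution_B (hn : 0 < n) (hm : 1 < m) (hdvd : m ∣ M + 2) :
    IsSchlesingerSolution (config M) (B M n m) := by
  have hpd : ∀ (i : Fin (M + 2)) (a : Fin M → ℂ) (j : Fin M) (r c : Fin 2),
      pd (fun x => B M n m i x r c) j a =
        !![0, MvPolynomial.eval a (MvPolynomial.pderiv j (b M n m i)); 0, 0] r c := by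
    intro i a j r c
    fin_cases r <;> fin_cases c <;> simp [B, pd, (hasDerivAt_eval_update _ a j).deriv]
  have hcomm : ∀ (i k : Fin (M + 2)) (a : Fin M → ℂ) (r c : Fin 2),
      (B M n m i a * B M n m k a - B M n m k a * B M n m i a) r c =
        !![0, (n : ℂ) / m * (MvPolynomial.eval a (b M n m k)
          - MvPolynomial.eval a (b M n m i)); 0, 0] r c := by
    intro i k a r c
    fin_cases r <;> fin_cases c <;> simp [B, mul_comm]
    ring
  refine ⟨fun i r c => ?_, fun a ha j => ⟨fun i hij r c => ?_, fun r c => ?_⟩⟩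
  · refine Differentiable.differentiableOn ?_
    fin_cases r <;> fin_cases c <;> simp [B]
    exact (contDiff_eval (k := 1) _).differentiable one_ne_zero
  · rw [hpd, hcomm]
    fin_cases r <;> fin_cases c <;> simp
    exact eval_pderiv_b_of_ne ha hij
  · rw [hpd]
    simp only [hcomm]
    have h := eval_pderiv_b_self (n := n) hn hm hdvd a j
    rw [Finset.sum_congr rfl fun l hl =>
      eval_pderiv_b_of_ne (n := n) (m := m) ha (Finset.ne_of_mem_erase hl)] at h
    fin_cases r <;> fin_cases c
    · simp
    · change MvPolynomial.eval a (MvPolynomial.pderiv j (b M n m (Fin.castAdd 2 j))) = _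
      rw [h, neg_inj]
      refine Finset.sum_congr rfl fun l _ => ?_
      rw [← neg_sub (a j), div_neg, ← neg_div, ← mul_neg, neg_sub]
      rfl
    · simp
    · simp

theorem sum_B (hn : 0 < n) (hm : 1 < m) (hdvd : m ∣ M + 2) (a : Fin M → ℂ) :
    ∑ i, B M n m i a =
      !![((M : ℂ) + 2) * n / (2 * m), 0; 0, -(((M : ℂ) + 2) * n / (2 * m))] := by
  ext r c
  rw [Matrix.sum_apply]
  fin_cases r <;> fin_cases c <;> simp [B, sum_eval_b hn hm hdvd]
  all_goals ring

theorem natCast_div_ne_natCast (hm : 1 < m) (hnm : Nat.Coprime n m) (k : ℕ) :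
    (n : ℂ) / m ≠ k := by
  have hm0 : (m : ℂ) ≠ 0 := by exact_mod_cast (by lia : m ≠ 0)
  rw [Ne, div_eq_iff hm0]
  intro h
  have h2 : n = k * m := by exact_mod_cast h
  have : m ∣ n := ⟨k, by rw [h2, mul_comm]⟩
  have := Nat.Coprime.eq_one_of_dvd hnm.symm this
  lia

/-- At `a = 0` the only nonzero node is `1`, so the generating series is just `(1 + t)^c`. -/
theorem eval_zero_b (i : Fin (M + 2)) (hi : i ≠ Fin.natAdd M 1) :
    MvPolynomial.eval 0 (b M n m i) = Ring.choose ((n : ℂ) / m) ((M + 2) / m * n) := by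
  have hnode : ∀ l, node (0 : Fin M → ℂ) l = if l = Fin.natAdd M 1 then 1 else 0 := by
    intro l
    refine Fin.addCases (fun i => ?_) (fun k => ?_) l
    · rw [node_castAdd, if_neg]
      · rfl
      · intro h
        have := congrArg Fin.val h
        have := i.2
        simp at *
        lia
    · rw [node_natAdd]
      fin_cases k <;> simp
  have hbin : binom ((n : ℂ) / m) (0 : ℂ) = 1 := by
    ext k
    rcases k with _ | k <;> simp [binom, PowerSeries.coeff_one]
  have hgeom : geom (0 : ℂ) = 1 := by
    ext k
    rcases k with _ | k <;> simp [geom, PowerSeries.coeff_one]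
  have h := map_bCoeff (MvPolynomial.aeval (0 : Fin M → ℂ)) ((n : ℂ) / m) ((M + 2) / m * n)
    (node (MvPolynomial.X (R := ℂ) : Fin M → MvPolynomial (Fin M) ℂ)) i
  have h2 : (fun l => (MvPolynomial.aeval (0 : Fin M → ℂ))
      (node (MvPolynomial.X (R := ℂ) : Fin M → MvPolynomial (Fin M) ℂ) l)) =
      fun l => if l = Fin.natAdd M 1 then (1 : ℂ) else 0 := by
    ext l
    rw [← hnode l]
    have := map_node (MvPolynomial.eval (0 : Fin M → ℂ)) (MvPolynomial.X (R := ℂ)) l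
    simpa [MvPolynomial.aeval_eq_eval, MvPolynomial.eval_X] using! this
  rw [← b_eq_bCoeff, h2] at h
  change MvPolynomial.eval 0 (b M n m i) = _ at h
  rw [h, bCoeff, Finset.prod_eq_single (Fin.natAdd M 1)]
  · simp [hi, hgeom, binom]
  · intro l _ hl
    simp [hl, hbin]
  · simp

end

section

/-! ### Rational functions with simple poles -/

section Nodal

open Polynomial Lagrange

theorem eval_derivative_nodal {ι : Type*} (s : Finset ι) (x : ι → ℂ) {z : ℂ}
    (hz : ∀ l ∈ s, z ≠ x l) :
    (derivative (nodal s x)).eval z = (nodal s x).eval z * ∑ l ∈ s, 1 / (z - x l) := by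
  classical
  rw [derivative_nodal, eval_finsetSum, Finset.mul_sum]
  refine Finset.sum_congr rfl fun l hl => ?_
  rw [nodal_eq_mul_nodal_erase hl]
  have : z - x l ≠ 0 := sub_ne_zero.mpr (hz l hl)
  simp
  field_simp

theorem eval_nodal_ne_zero {ι : Type*} (s : Finset ι) (x : ι → ℂ) {z : ℂ}
    (hz : ∀ l ∈ s, z ≠ x l) : (nodal s x).eval z ≠ 0 :=
  eval_nodal_not_at_node hz

theorem eval_derivative_nodal_node_ne_zero {ι : Type*} [Fintype ι] {x : ι → ℂ}
    (hx : Function.Injective x) (i : ι) : (derivative (nodal Finset.univ x)).eval (x i) ≠ 0 := by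
  classical
  rw [eval_nodal_derivative_eval_node_eq (Finset.mem_univ i)]
  exact eval_nodal_ne_zero _ _ fun l hl h => (Finset.ne_of_mem_erase hl) (hx h.symm)

/-- Partial fractions of `Γ / Λ` when `deg Γ ≤ deg Λ`. -/
theorem eval_div_eval_nodal {ι : Type*} [Fintype ι] {y : ι → ℂ} (hy : Function.Injective y)
    {Γ : ℂ[X]} (hΓ : Γ.natDegree ≤ Fintype.card ι) {z : ℂ} (hz : ∀ k, z ≠ y k) :
    Γ.eval z / (nodal Finset.univ y).eval z = Γ.coeff (Fintype.card ι) +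
      ∑ k, Γ.eval (y k) / (derivative (nodal Finset.univ y)).eval (y k) * (z - y k)⁻¹ := by
  classical
  set N : ℂ[X] := nodal Finset.univ y with hN
  have hNd : N.natDegree = Fintype.card ι := by rw [hN, natDegree_nodal]; rfl
  have hN1 : N.coeff (Fintype.card ι) = 1 := by
    rw [← hNd]; exact nodal_monic
  have hNz : N.eval z ≠ 0 := eval_nodal_ne_zero _ _ fun l _ => hz l
  -- Removing the top coefficient leaves a remainder of degree below the number of nodes, with the
  -- same values at them; it equals its Lagrange interpolant.
  set Δ : ℂ[X] := Γ - C (Γ.coeff (Fintype.card ι)) * N with hΔ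
  have hdeg : Δ.degree < (Finset.univ : Finset ι).card := by
    rw [Finset.card_univ, degree_lt_iff_coeff_zero]
    intro k hk
    rcases hk.eq_or_lt with rfl | hk
    · simp [hΔ, hN1]
    · rw [hΔ, coeff_sub, coeff_C_mul, coeff_eq_zero_of_natDegree_lt (hΓ.trans_lt hk),
        coeff_eq_zero_of_natDegree_lt (p := N) (hNd.trans_lt hk)]
      simp
  have hΔy : ∀ k, Δ.eval (y k) = Γ.eval (y k) := by
    intro k
    simp [hΔ, hN, eval_nodal_at_node]
  have h := congrArg (eval z) (eq_interpolate (s := Finset.univ) hy.injOn hdeg)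
  rw [eval_interpolate_not_at_node _ fun k _ => hz k, ← hN] at h
  have h2 : Γ.eval z = Γ.coeff (Fintype.card ι) * N.eval z + Δ.eval z := by simp [hΔ]
  rw [h2, h, add_div, mul_div_cancel_right₀ _ hNz, mul_div_cancel_left₀ _ hNz]
  congr 1
  refine Finset.sum_congr rfl fun k _ => ?_
  rw [nodalWeight_eq_eval_derivative_nodal (Finset.mem_univ k), hΔy, ← hN]
  ring

/-- The sum of the residues of `Γ / ((x - z) ^ 2 Λ)` vanishes when `deg Γ ≤ deg Λ`. -/
theorem sum_eval_div_sq {ι : Type*} [Fintype ι] {y : ι → ℂ} (hy : Function.Injective y)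
    {Γ : ℂ[X]} (hΓ : Γ.natDegree ≤ Fintype.card ι) {z : ℂ} (hz : ∀ k, z ≠ y k) :
    ∑ k, Γ.eval (y k) / ((y k - z) ^ 2 * (derivative (nodal Finset.univ y)).eval (y k)) =
      -((derivative Γ).eval z * (nodal Finset.univ y).eval z
        - Γ.eval z * (derivative (nodal Finset.univ y)).eval z)
          / (nodal Finset.univ y).eval z ^ 2 := by
  set N : ℂ[X] := nodal Finset.univ y with hN
  have hNz : N.eval z ≠ 0 := eval_nodal_ne_zero _ _ fun l _ => hz l
  -- Both sides of the partial fraction expansion are differentiated at `z`.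
  have h1 : HasDerivAt (fun w => Γ.eval w / N.eval w)
      (((derivative Γ).eval z * N.eval z - Γ.eval z * (derivative N).eval z) / N.eval z ^ 2) z :=
    (Γ.hasDerivAt z).div (N.hasDerivAt z) hNz
  have h2 : HasDerivAt (fun w => Γ.coeff (Fintype.card ι) +
      ∑ k, Γ.eval (y k) / (derivative N).eval (y k) * (w - y k)⁻¹)
      (∑ k, Γ.eval (y k) / (derivative N).eval (y k) * (-1 / (z - y k) ^ 2)) z := by
    refine HasDerivAt.const_add _ (HasDerivAt.fun_sum fun k _ => HasDerivAt.const_mul _ ?_)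
    exact ((hasDerivAt_id' z).sub_const (y k)).inv (sub_ne_zero.mpr (hz k))
  have h3 : (fun w => Γ.eval w / N.eval w) =ᶠ[nhds z] fun w => Γ.coeff (Fintype.card ι) +
      ∑ k, Γ.eval (y k) / (derivative N).eval (y k) * (w - y k)⁻¹ := by
    have : ∀ᶠ w in nhds z, ∀ k, w ≠ y k :=
      Filter.eventually_all.mpr fun k => isOpen_ne.mem_nhds (hz k)
    filter_upwards [this] with w hw
    exact eval_div_eval_nodal hy hΓ hw
  have h4 := h1.unique (h2.congr_of_eventuallyEq h3)
  rw [neg_div, h4, ← Finset.sum_neg_distrib]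
  refine Finset.sum_congr rfl fun k _ => ?_
  rw [← neg_sub (y k) z, neg_sq, neg_div, mul_neg, neg_neg, div_mul_div_comm, mul_one,
    mul_comm ((y k - z) ^ 2)]

theorem coeff_X_mul_derivative (p : ℂ[X]) (k : ℕ) : (X * derivative p).coeff k = k * p.coeff k := by
  rcases k with _ | k
  · simp
  · rw [coeff_X_mul, coeff_derivative]
    push_cast
    ring

theorem natDegree_X_mul_derivative_le (p : ℂ[X]) : (X * derivative p).natDegree ≤ p.natDegree := by
  rw [natDegree_le_iff_coeff_eq_zero]
  intro k hk
  rw [coeff_X_mul_derivative, coeff_eq_zero_of_natDegree_lt hk, mul_zero]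

end Nodal

/-! ### The Hamiltonians along `v_k = ∑ w_l / (u_k - a_l)` -/

open Polynomial Lagrange

variable {M : ℕ}

/-- The numerator `(x - a_j) T(x) W(x)`, where `W` is the bracket in `H_j` for
`v = c ∑_{l ∈ S} 1 / (x - a_l)`. -/
def bracketNumerator (c κ : ℂ) (S : Finset (Fin (M + 2))) (a : Fin M → ℂ) (j : Fin M) : ℂ[X] :=
  (X - C (a j)) * (C (c ^ 2) * (derivative (nodal S (node a)) * derivative (nodal Sᶜ (node a)))
      + C κ * nodal Finset.univ a)
    + C c * (derivative (nodal S (node a)) * nodal Sᶜ (node a))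

/-- A priori the degree is at most `M + 1`, with top coefficient `c² |S| |Sᶜ| + κ + c |S|`; the
hypothesis on `κ` says that this vanishes. -/
theorem natDegree_bracketNumerator_le {c κ : ℂ} {S : Finset (Fin (M + 2))} (a : Fin M → ℂ)
    (j : Fin M) (hκ : κ = c * S.card * (c * S.card - c * (M + 2) - 1)) :
    (bracketNumerator c κ S a j).natDegree ≤ M := by
  set p : ℂ[X] := nodal S (node a) with hp
  set q : ℂ[X] := nodal Sᶜ (node a) with hq
  set r : ℂ[X] := nodal Finset.univ a with hr
  have hpd : p.natDegree = S.card := natDegree_nodal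
  have hqd : q.natDegree = Sᶜ.card := natDegree_nodal
  have hrd : r.natDegree = M := by rw [hr, natDegree_nodal]; simp
  have hp1 : p.coeff S.card = 1 := by rw [← hpd]; exact nodal_monic
  have hq1 : q.coeff Sᶜ.card = 1 := by rw [← hqd]; exact nodal_monic
  have hr1 : r.coeff M = 1 := by
    have : r.coeff r.natDegree = 1 := nodal_monic
    rwa [hrd] at this
  have hcard : S.card + Sᶜ.card = M + 2 := by
    rw [Finset.card_add_card_compl, Fintype.card_fin]
  have hp' := (natDegree_X_mul_derivative_le p).trans hpd.le
  have hq' := (natDegree_X_mul_derivative_le q).trans hqd.le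
  -- After multiplication by `X²` only `X p'` and `X q'` occur. Their `k`-th coefficients are `k`
  -- times those of `p` and `q`, which avoids truncated subtraction when `S` or its complement is
  -- empty.
  have e : X ^ 2 * bracketNumerator c κ S a j =
      (X - C (a j)) * (C (c ^ 2) * ((X * derivative p) * (X * derivative q))
        + C κ * (X ^ 2 * r)) + C c * (X * ((X * derivative p) * q)) := by
    rw [bracketNumerator]
    ring
  have d1 : ((X * derivative p) * (X * derivative q)).natDegree ≤ M + 2 :=
    hcard ▸ natDegree_mul_le_of_le hp' hq'
  have d2 : (X ^ 2 * r).natDegree ≤ M + 2 := by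
    have := natDegree_mul_le_of_le (natDegree_X_pow_le (R := ℂ) 2) hrd.le
    lia
  have d3 : ((X * derivative p) * q).natDegree ≤ M + 2 :=
    hcard ▸ natDegree_mul_le_of_le hp' hqd.le
  have d4 : (C (c ^ 2) * ((X * derivative p) * (X * derivative q))
        + C κ * (X ^ 2 * r)).natDegree ≤ M + 2 :=
    natDegree_add_le_of_degree_le ((natDegree_C_mul_le _ _).trans d1)
      ((natDegree_C_mul_le _ _).trans d2)
  have c1 : ((X * derivative p) * (X * derivative q)).coeff (M + 2) =
      (S.card : ℂ) * (Sᶜ.card : ℂ) := by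
    have := coeff_mul_add_eq_of_natDegree_le hp' hq'
    rw [hcard] at this
    rw [this, coeff_X_mul_derivative, coeff_X_mul_derivative,
      hp1, hq1]
    ring
  have c2 : (X ^ 2 * r).coeff (M + 2) = 1 := by
    rw [coeff_X_pow_mul, hr1]
  have c3 : ((X * derivative p) * q).coeff (M + 2) = (S.card : ℂ) := by
    have := coeff_mul_add_eq_of_natDegree_le hp' hqd.le
    rw [hcard] at this
    rw [this, coeff_X_mul_derivative, hp1, hq1]
    ring
  have hS : ((Sᶜ).card : ℂ) = M + 2 - S.card := by
    have : ((S.card + Sᶜ.card : ℕ) : ℂ) = ((M + 2 : ℕ) : ℂ) := by rw [hcard]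
    push_cast at this
    linear_combination this
  rw [natDegree_le_iff_coeff_eq_zero]
  intro k hk
  rw [← coeff_X_pow_mul _ 2 k, e]
  rcases (Nat.succ_le_of_lt hk).eq_or_lt with rfl | hk
  · rw [coeff_add, sub_mul, coeff_sub, show M.succ + 2 = M + 2 + 1 by lia, coeff_X_mul,
      coeff_C_mul, coeff_C_mul, coeff_X_mul, coeff_add, coeff_C_mul, coeff_C_mul, c1, c2, c3,
      coeff_eq_zero_of_natDegree_lt (lt_of_le_of_lt d4 (Nat.lt_succ_self _)), hκ, hS]
    ring
  · refine coeff_eq_zero_of_natDegree_lt ?_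
    refine lt_of_le_of_lt (b := M + 3) ?_ (by lia)
    refine natDegree_add_le_of_degree_le ?_ ?_
    · have := natDegree_mul_le_of_le (natDegree_X_sub_C_le (a j)) d4
      lia
    · refine (natDegree_C_mul_le _ _).trans ?_
      have := natDegree_mul_le_of_le (natDegree_X_le (R := ℂ)) d3
      lia

theorem T_eq_nodal (a : Fin M → ℂ) : T a = nodal Finset.univ (node a) := rfl

theorem Lam_eq_nodal (u : Fin M → ℂ) : Lam u = nodal Finset.univ u := rfl

theorem T_eq_mul (S : Finset (Fin (M + 2))) (a : Fin M → ℂ) :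
    T a = nodal S (node a) * nodal Sᶜ (node a) := by
  rw [T, nodal, nodal, Finset.prod_mul_prod_compl]

theorem eval_T (a : Fin M → ℂ) (z : ℂ) :
    (T a).eval z = (nodal Finset.univ a).eval z * (z * (z - 1)) := by
  rw [T_eq_nodal, eval_nodal, eval_nodal, Fin.prod_univ_add]
  simp [node_natAdd]

/-- Write `V = c s₁` for the sum over `S` and `s₂` for the sum of `1 / (z - a_l)` over the
complement. The linear coefficient is `c s₁ - c s₂ - 1 / (z - a_j)`, so `V²` cancels and the bracket
is `c² s₁ s₂ + c s₁ / (z - a_j) + κ / (z (z - 1))`, with at most simple poles off `a_j`. -/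
theorem eval_bracketNumerator (c κ : ℂ) (S : Finset (Fin (M + 2))) (a : Fin M → ℂ) (j : Fin M)
    {z : ℂ} (hz : ∀ l, z ≠ node a l) {θ : Fin (M + 2) → ℂ}
    (hθ : ∀ l, θ l = if l ∈ S then c else -c) :
    (bracketNumerator c κ S a j).eval z = (z - a j) * (T a).eval z *
      ((∑ l ∈ S, c / (z - node a l)) ^ 2
        - (∑ l, (θ l - if l = Fin.castAdd 2 j then 1 else 0) / (z - node a l))
          * (∑ l ∈ S, c / (z - node a l))
        + κ / (z * (z - 1))) := by
  have hS := eval_derivative_nodal S (node a) fun l _ => hz l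
  have hS' := eval_derivative_nodal Sᶜ (node a) fun l _ => hz l
  set s1 := ∑ l ∈ S, 1 / (z - node a l) with hs1
  set s2 := ∑ l ∈ Sᶜ, 1 / (z - node a l) with hs2
  have e1 : ∑ l ∈ S, c / (z - node a l) = c * s1 := by
    rw [hs1, Finset.mul_sum]
    exact Finset.sum_congr rfl fun l _ => by ring
  have hzj : z - a j ≠ 0 := sub_ne_zero.mpr (by simpa using hz (Fin.castAdd 2 j))
  have hz0 : z ≠ 0 := by simpa [node_natAdd] using hz (Fin.natAdd M 0)
  have hz1 : z - 1 ≠ 0 := sub_ne_zero.mpr (by simpa [node_natAdd] using hz (Fin.natAdd M 1))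
  have e2 : ∑ l, (θ l - if l = Fin.castAdd 2 j then 1 else 0) / (z - node a l) =
      c * s1 - c * s2 - 1 / (z - a j) := by
    simp only [sub_div, Finset.sum_sub_distrib]
    congr 1
    · rw [← Finset.sum_add_sum_compl S, hs1, hs2, Finset.mul_sum, Finset.mul_sum, sub_eq_add_neg,
        ← Finset.sum_neg_distrib]
      congr 1
      · refine Finset.sum_congr rfl fun l hl => ?_
        rw [hθ, if_pos hl]
        ring
      · refine Finset.sum_congr rfl fun l hl => ?_
        rw [hθ, if_neg (Finset.mem_compl.mp hl)]
        ring
    · simp [ite_div]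
  rw [e1, e2, bracketNumerator]
  simp only [eval_add, eval_mul, eval_sub, eval_X, eval_C, hS, hS']
  have hT : (T a).eval z = (nodal S (node a)).eval z * (nodal Sᶜ (node a)).eval z := by
    rw [T_eq_mul S, eval_mul]
  have hκ : (T a).eval z * (κ / (z * (z - 1))) = κ * (nodal Finset.univ a).eval z := by
    rw [eval_T]
    field_simp
  have : (z - a j) * (1 / (z - a j)) = 1 := by field_simp
  linear_combination -(z - a j) * hκ - ((z - a j) * c ^ 2 * s1 * s2 + c * s1) * hT
    - (T a).eval z * c * s1 * this

/-- Along `v_k = c ∑_{l ∈ S} 1 / (u_k - a_l)` the Hamiltonian `H_j` is, up to a function of `a`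
alone, `c ∑_k 1 / (u_k - a_j)` or `0`, according to whether `j ∈ S`. -/
theorem exists_H_eq {c θinf : ℂ} {S : Finset (Fin (M + 2))} {θ : Fin (M + 2) → ℂ}
    {a : Fin M → ℂ} (ha : a ∈ config M) (j : Fin M)
    (hθ : ∀ l, θ l = if l ∈ S then c else -c)
    (hκ : kappa θ θinf = c * S.card * (c * S.card - c * (M + 2) - 1)) :
    ∃ K : ℂ, ∀ y : Fin M → ℂ, Function.Injective y → (∀ k l, y k ≠ node a l) →
      H θ θinf j a y (fun k => ∑ l ∈ S, c / (y k - node a l)) =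
        K + (if Fin.castAdd 2 j ∈ S then c else 0) * ∑ k, 1 / (y k - a j) := by
  set κ := kappa θ θinf with hκ'
  set Γ := bracketNumerator c κ S a j with hΓ
  have hT' : (derivative (T a)).eval (a j) ≠ 0 := by
    have := eval_derivative_nodal_node_ne_zero (x := node a) ha (Fin.castAdd 2 j)
    rwa [node_castAdd] at this
  -- At `a_j` only `c p' q` survives, where `T = p q`; it equals `c T'` if `p` vanishes there and
  -- `0` if `q` does.
  have hΓj : Γ.eval (a j) =
      (if Fin.castAdd 2 j ∈ S then c else 0) * (derivative (T a)).eval (a j) := by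
    rw [hΓ, bracketNumerator, T_eq_mul S, derivative_mul]
    split_ifs with h
    · have : (nodal S (node a)).eval (a j) = 0 := by
        rw [← node_castAdd a j]; exact eval_nodal_at_node h
      simp [this]
    · have : (nodal Sᶜ (node a)).eval (a j) = 0 := by
        rw [← node_castAdd a j]; exact eval_nodal_at_node (Finset.mem_compl.mpr h)
      simp [this]
  refine ⟨(derivative Γ).eval (a j) / (derivative (T a)).eval (a j), fun y hy hya => ?_⟩
  have hyj : ∀ k, a j ≠ y k := fun k => by
    simpa using (hya k (Fin.castAdd 2 j)).symm
  have hsum := sum_eval_div_sq hy (Γ := Γ)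
    (by rw [Fintype.card_fin]; exact natDegree_bracketNumerator_le a j hκ) hyj
  have hlog := eval_derivative_nodal Finset.univ y (z := a j) fun k _ => hyj k
  have hΛ : (nodal Finset.univ y).eval (a j) ≠ 0 := eval_nodal_ne_zero _ _ fun k _ => hyj k
  have hneg : ∑ k, 1 / (a j - y k) = -∑ k, 1 / (y k - a j) := by
    rw [← Finset.sum_neg_distrib]
    refine Finset.sum_congr rfl fun k _ => ?_
    rw [← neg_sub (y k), div_neg]
  have hterm : ∀ k, (T a).eval (y k) / ((y k - a j) * (derivative (Lam y)).eval (y k)) *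
      ((∑ l ∈ S, c / (y k - node a l)) ^ 2
        - (∑ l, (θ l - if l = Fin.castAdd 2 j then 1 else 0) / (y k - node a l))
          * (∑ l ∈ S, c / (y k - node a l))
        + κ / (y k * (y k - 1))) =
      Γ.eval (y k) / ((y k - a j) ^ 2 * (derivative (nodal Finset.univ y)).eval (y k)) := by
    intro k
    have h1 : y k - a j ≠ 0 := sub_ne_zero.mpr (hyj k).symm
    have h2 := eval_derivative_nodal_node_ne_zero hy k
    rw [hΓ, eval_bracketNumerator c κ S a j (hya k) hθ, Lam_eq_nodal]
    field_simp
  rw [H, Finset.sum_congr rfl fun k _ => hterm k, hsum, hlog, hneg, hΓj, Lam_eq_nodal]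
  field_simp
  ring

end

section

open Polynomial Lagrange

variable {M : ℕ}

/-! ### Partial derivatives of the Hamiltonians -/

/-- The coefficient of `v_k ^ 2` in `H_j`. -/
def HCoeff (j : Fin M) (a u : Fin M → ℂ) (k : Fin M) : ℂ :=
  -((Lam u).eval (a j) / (T a).derivative.eval (a j)) *
    ((T a).eval (u k) / ((u k - a j) * (Lam u).derivative.eval (u k)))

/-- The function `∑_l (θ_l - δ_{lj}) / (z - a_l)`. -/
def HLin (θ : Fin (M + 2) → ℂ) (j : Fin M) (a : Fin M → ℂ) (z : ℂ) : ℂ :=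
  ∑ l, (θ l - if l = Fin.castAdd 2 j then 1 else 0) / (z - node a l)

theorem H_eq_sum (θ : Fin (M + 2) → ℂ) (θinf : ℂ) (j : Fin M) (a u v : Fin M → ℂ) :
    H θ θinf j a u v = ∑ k, HCoeff j a u k *
      (v k ^ 2 - HLin θ j a (u k) * v k + kappa θ θinf / (u k * (u k - 1))) := by
  rw [H, Finset.mul_sum]
  refine Finset.sum_congr rfl fun k _ => ?_
  rw [HCoeff, HLin]
  ring

/-- `H_j` is quadratic in each `v_i` without cross terms, so its increment factors exactly. -/
theorem H_update (θ : Fin (M + 2) → ℂ) (θinf : ℂ) (j : Fin M) (a u v : Fin M → ℂ) (i : Fin M)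
    (s : ℂ) : H θ θinf j a u (Function.update v i s) = H θ θinf j a u v +
      HCoeff j a u i * ((s - v i) * (s + v i - HLin θ j a (u i))) := by
  rw [H_eq_sum, H_eq_sum, ← Finset.add_sum_erase _ _ (Finset.mem_univ i),
    ← Finset.add_sum_erase _ _ (Finset.mem_univ i)]
  rw [Finset.sum_congr (g := fun k => HCoeff j a u k *
      (v k ^ 2 - HLin θ j a (u k) * v k + kappa θ θinf / (u k * (u k - 1)))) rfl
      fun k hk => by rw [Function.update_of_ne (Finset.ne_of_mem_erase hk)]]
  rw [Function.update_self]
  ring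

theorem pd_H_right (θ : Fin (M + 2) → ℂ) (θinf : ℂ) (j : Fin M) (a u v : Fin M → ℂ) (i : Fin M) :
    pd (fun y => H θ θinf j a u y) i v = HCoeff j a u i * (2 * v i - HLin θ j a (u i)) := by
  rw [pd]
  simp only [H_update]
  refine HasDerivAt.deriv ?_
  have h1 : HasDerivAt (fun s : ℂ => s - v i) 1 (v i) := (hasDerivAt_id' (v i)).sub_const _
  have h2 : HasDerivAt (fun s : ℂ => s + v i - HLin θ j a (u i)) 1 (v i) :=
    ((hasDerivAt_id' (v i)).add_const _).sub_const _
  refine (((h1.mul h2).const_mul (HCoeff j a u i)).const_add _).congr_deriv ?_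
  ring

/-- Isolates the dependence on `u_i`: one linear factor of `Λ(a_j)`, and `Λ'(u_i)` as a product over
the other zeros. -/
theorem HCoeff_update {j : Fin M} {a u : Fin M → ℂ} (i : Fin M) (s : ℂ) :
    HCoeff j a (Function.update u i s) i =
      -((a j - s) * (nodal (Finset.univ.erase i) u).eval (a j) / (T a).derivative.eval (a j)) *
        ((T a).eval s / ((s - a j) * (nodal (Finset.univ.erase i) u).eval s)) := by
  have e : ∀ z, (nodal (Finset.univ.erase i) (Function.update u i s)).eval z =
      (nodal (Finset.univ.erase i) u).eval z := by
    intro z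
    rw [eval_nodal, eval_nodal]
    refine Finset.prod_congr rfl fun k hk => ?_
    rw [Function.update_of_ne (Finset.ne_of_mem_erase hk)]
  have h := eval_nodal_derivative_eval_node_eq (v := Function.update u i s) (Finset.mem_univ i)
  rw [Function.update_self] at h
  rw [HCoeff, Lam_eq_nodal, Function.update_self, h, e,
    nodal_eq_mul_nodal_erase (Finset.mem_univ i), eval_mul, e, Function.update_self]
  simp

theorem differentiableAt_HCoeff_update {j : Fin M} {a u : Fin M → ℂ} (hu : Function.Injective u)
    (hua : ∀ k l, u k ≠ node a l) (i : Fin M) :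
    DifferentiableAt ℂ (fun s => HCoeff j a (Function.update u i s) i) (u i) := by
  simp only [HCoeff_update]
  have h1 : u i - a j ≠ 0 := sub_ne_zero.mpr (by simpa using hua i (Fin.castAdd 2 j))
  have h2 : (nodal (Finset.univ.erase i) u).eval (u i) ≠ 0 :=
    eval_nodal_ne_zero _ _ fun k hk h => Finset.ne_of_mem_erase hk (hu h.symm)
  fun_prop (disch := exact mul_ne_zero h1 h2)

theorem injective_update_of_ne {u : Fin M → ℂ} (hu : Function.Injective u) {i : Fin M} {s : ℂ}
    (hs : ∀ k, k ≠ i → s ≠ u k) : Function.Injective (Function.update u i s) := by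
  intro k l h
  by_cases hk : k = i <;> by_cases hl : l = i
  · rw [hk, hl]
  · subst hk
    rw [Function.update_self, Function.update_of_ne hl] at h
    exact absurd h (hs l hl)
  · subst hl
    rw [Function.update_self, Function.update_of_ne hk] at h
    exact absurd h.symm (hs k hk)
  · rw [Function.update_of_ne hl, Function.update_of_ne hk] at h
    exact hu h

theorem hasDerivAt_sum_div_sub {ι : Type*} (S : Finset ι) (w x : ι → ℂ) {z : ℂ}
    (hz : ∀ l ∈ S, z ≠ x l) :
    HasDerivAt (fun s => ∑ l ∈ S, w l / (s - x l)) (-∑ l ∈ S, w l / (z - x l) ^ 2) z := by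
  rw [← Finset.sum_neg_distrib]
  refine HasDerivAt.fun_sum fun l hl => ?_
  have h := (((hasDerivAt_id' z).sub_const (x l)).inv (sub_ne_zero.mpr (hz l hl))).const_mul (w l)
  refine (h.congr_deriv ?_).congr_of_eventuallyEq (Filter.Eventually.of_forall fun s => ?_)
  · ring
  · simp [div_eq_mul_inv]

/-- Here `v` is frozen, while `exists_H_eq` needs `v_i = V(u_i)` to move along. By `H_update` the
discrepancy has the factor `V(s) - v_i`, zero at `s = u_i`; hence the derivatives of `HCoeff` and
`HLin` drop out and `∂H_j/∂v_i` times `-V'(u_i)` remains. -/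
theorem pd_H_left {c θinf : ℂ} {S : Finset (Fin (M + 2))} {θ : Fin (M + 2) → ℂ}
    {a : Fin M → ℂ} (ha : a ∈ config M) (j : Fin M)
    (hθ : ∀ l, θ l = if l ∈ S then c else -c)
    (hκ : kappa θ θinf = c * S.card * (c * S.card - c * (M + 2) - 1))
    {u v : Fin M → ℂ} (hu : Function.Injective u) (hua : ∀ k l, u k ≠ node a l)
    (hv : ∀ k, v k = ∑ l ∈ S, c / (u k - node a l)) (i : Fin M) :
    pd (fun y => H θ θinf j a y v) i u =
      -((if Fin.castAdd 2 j ∈ S then c else 0) / (u i - a j) ^ 2)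
        + (HCoeff j a u i * (2 * v i - HLin θ j a (u i)))
          * ∑ l ∈ S, c / (u i - node a l) ^ 2 := by
  obtain ⟨K, hK⟩ := exists_H_eq (θinf := θinf) ha j hθ hκ
  set w := if Fin.castAdd 2 j ∈ S then c else 0 with hw
  set V : ℂ → ℂ := fun z => ∑ l ∈ S, c / (z - node a l) with hV
  have hui : ∀ k, u k - a j ≠ 0 := fun k =>
    sub_ne_zero.mpr (by simpa using hua k (Fin.castAdd 2 j))
  set R := ∑ k ∈ Finset.univ.erase i, 1 / (u k - a j) with hR
  have hev : (fun s => H θ θinf j a (Function.update u i s) v) =ᶠ[nhds (u i)] fun s =>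
      K + w * (1 / (s - a j) + R) - HCoeff j a (Function.update u i s) i *
        ((V s - v i) * (V s + v i - HLin θ j a s)) := by
    have h1 : ∀ᶠ s in nhds (u i), ∀ k, k ≠ i → s ≠ u k :=
      Filter.eventually_all.mpr fun k => by
        by_cases hk : k = i
        · simp [hk]
        · filter_upwards [isOpen_ne.mem_nhds (show u i ≠ u k from fun h => hk (hu h.symm))]
            with s hs _ using hs
    have h2 : ∀ᶠ s in nhds (u i), ∀ l, s ≠ node a l :=
      Filter.eventually_all.mpr fun l => isOpen_ne.mem_nhds (hua i l)
    filter_upwards [h1, h2] with s hs1 hs2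
    have h3 := hK (Function.update u i s) (injective_update_of_ne hu hs1) (fun k l => by
      by_cases hk : k = i
      · subst hk; simpa using hs2 l
      · simpa [hk] using hua k l)
    have h4 : (fun k => ∑ l ∈ S, c / (Function.update u i s k - node a l)) =
        Function.update v i (V s) := by
      ext k
      by_cases hk : k = i
      · subst hk; simp [hV]
      · simp [hk, hv]
    have h5 : ∑ k, 1 / (Function.update u i s k - a j) = 1 / (s - a j) + R := by
      rw [← Finset.add_sum_erase _ _ (Finset.mem_univ i), Function.update_self, hR]
      congr 1
      refine Finset.sum_congr rfl fun k hk => ?_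
      rw [Function.update_of_ne (Finset.ne_of_mem_erase hk)]
    rw [h4, H_update, h5, Function.update_self] at h3
    linear_combination h3
  rw [pd, hev.deriv_eq]
  refine HasDerivAt.deriv ?_
  have d1 : HasDerivAt (fun s => 1 / (s - a j)) (-(1 / (u i - a j) ^ 2)) (u i) := by
    have := hasDerivAt_sum_div_sub {()} (fun _ => 1) (fun _ => a j) (z := u i)
      fun _ _ => sub_ne_zero.mp (hui i)
    simpa using this
  have d2 : HasDerivAt V (-∑ l ∈ S, c / (u i - node a l) ^ 2) (u i) :=
    hasDerivAt_sum_div_sub S (fun _ => c) (node a) fun l _ => hua i l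
  have d3 : HasDerivAt (fun s => HLin θ j a s)
      (-∑ l, (θ l - if l = Fin.castAdd 2 j then 1 else 0) / (u i - node a l) ^ 2) (u i) :=
    hasDerivAt_sum_div_sub Finset.univ _ (node a) fun l _ => hua i l
  have d4 := (differentiableAt_HCoeff_update (j := j) hu hua i).hasDerivAt
  have hVi : V (u i) = v i := (hv i).symm
  have d5 := ((((d1.add_const R).const_mul w).const_add K)).sub
    (d4.mul ((d2.sub_const (v i)).mul ((d2.add_const (v i)).sub d3)))
  refine d5.congr_deriv ?_
  simp only [Pi.mul_apply, Pi.sub_apply, hVi, Function.update_eq_self, sub_self]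
  ring

end

section

open Polynomial Lagrange
open scoped Topology

variable {M n m : ℕ}

/-! ### Zeros of `P_M` as functions of `a` -/

/-- The equivalence includes local uniqueness, by which a merely continuous branch is identified
with the smooth `ψ`. -/
theorem exists_implicitFunction {E : Type*} [NormedAddCommGroup E] [NormedSpace ℂ E]
    [CompleteSpace E] {f : E × ℂ → ℂ} {x₀ : E} {z₀ f' : ℂ} (hf : ContDiffAt ℂ 1 f (x₀, z₀))
    (hf' : HasDerivAt (fun z => f (x₀, z)) f' z₀) (h0 : f' ≠ 0) :
    ∃ ψ : E → ℂ, ContDiffAt ℂ 1 ψ x₀ ∧ ψ x₀ = z₀ ∧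
      ∀ᶠ p in 𝓝 (x₀, z₀), f p = f (x₀, z₀) ↔ ψ p.1 = p.2 := by
  have h1 : HasDerivAt (fun z => f (x₀, z)) (fderiv ℂ f (x₀, z₀) (0, 1)) z₀ :=
    (hf.differentiableAt one_ne_zero).hasFDerivAt.comp_hasDerivAt z₀
      ((hasDerivAt_const z₀ x₀).prodMk (hasDerivAt_id' z₀))
  have h2 : (fderiv ℂ f (x₀, z₀) ∘L .inr ℂ E ℂ).IsInvertible := by
    refine ⟨ContinuousLinearEquiv.unitsEquivAut ℂ (Units.mk0 f' h0), ?_⟩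
    ext
    simpa using hf'.unique h1
  exact ⟨hf.implicitFunction one_ne_zero h2, hf.contDiffAt_implicitFunction one_ne_zero h2,
    hf.implicitFunction_apply_self one_ne_zero h2,
    hf.eventually_apply_eq_iff_implicitFunction one_ne_zero h2⟩

theorem P_eq_sum_nodal (a : Fin M → ℂ) : P M n m a =
    ∑ i, C (MvPolynomial.eval a (b M n m i)) * nodal (Finset.univ.erase i) (node a) := rfl

theorem contDiff_eval_P : ContDiff ℂ 1 fun p : (Fin M → ℂ) × ℂ => (P M n m p.1).eval p.2 := by
  have h1 : ∀ i, ContDiff ℂ 1 fun p : (Fin M → ℂ) × ℂ => MvPolynomial.eval p.1 (b M n m i) :=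
    fun i => (contDiff_eval _).comp contDiff_fst
  have h2 : ∀ l, ContDiff ℂ 1 fun p : (Fin M → ℂ) × ℂ => node p.1 l :=
    fun l => (contDiff_node l).comp contDiff_fst
  simp only [P_eq_sum_nodal, eval_finsetSum, eval_mul, eval_C, eval_nodal]
  exact ContDiff.sum fun i _ => (h1 i).mul (contDiff_prod fun l _ => contDiff_snd.sub (h2 l))

theorem eval_P {a : Fin M → ℂ} {z : ℂ} (hz : ∀ l, z ≠ node a l) :
    (P M n m a).eval z =
      (T a).eval z * ∑ l, MvPolynomial.eval a (b M n m l) / (z - node a l) := by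
  rw [P_eq_sum_nodal, eval_finsetSum, Finset.mul_sum]
  refine Finset.sum_congr rfl fun l _ => ?_
  rw [T_eq_nodal, nodal_eq_mul_nodal_erase (Finset.mem_univ l)]
  have : z - node a l ≠ 0 := sub_ne_zero.mpr (hz l)
  simp
  field_simp

/-- Recovers `b_l` from `P_M`; in particular `a_l` is not a zero when `b_l(a) ≠ 0` and the nodes are
distinct. -/
theorem eval_P_node (a : Fin M → ℂ) (l : Fin (M + 2)) :
    (P M n m a).eval (node a l) =
      MvPolynomial.eval a (b M n m l) * (T a).derivative.eval (node a l) := by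
  rw [P_eq_sum_nodal, eval_finsetSum, Finset.sum_eq_single l]
  · rw [T_eq_nodal, eval_nodal_derivative_eval_node_eq (Finset.mem_univ l)]
    simp
  · intro k _ hk
    rw [eval_mul, eval_nodal_at_node (Finset.mem_erase.mpr ⟨hk.symm, Finset.mem_univ l⟩), mul_zero]
  · simp

theorem eval_derivative_P {a : Fin M → ℂ} {z : ℂ} (hz : ∀ l, z ≠ node a l)
    (h0 : ∑ l, MvPolynomial.eval a (b M n m l) / (z - node a l) = 0) :
    (P M n m a).derivative.eval z =
      -((T a).eval z * ∑ l, MvPolynomial.eval a (b M n m l) / (z - node a l) ^ 2) := by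
  have h1 := (P M n m a).hasDerivAt z
  have h2 := ((T a).hasDerivAt z).mul (hasDerivAt_sum_div_sub Finset.univ
    (fun l => MvPolynomial.eval a (b M n m l)) (node a) fun l _ => hz l)
  have h3 : ∀ᶠ w in 𝓝 z, ∀ l, w ≠ node a l :=
    Filter.eventually_all.mpr fun l => isOpen_ne.mem_nhds (hz l)
  have h4 := h1.unique (h2.congr_of_eventuallyEq (by
    filter_upwards [h3] with w hw
    exact eval_P hw))
  rw [h4, h0]
  ring

theorem IsZeroBranch.P_eq {U : Set (Fin M → ℂ)} {u : (Fin M → ℂ) → Fin M → ℂ}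
    (h : IsZeroBranch M n m U u) {a : Fin M → ℂ} (ha : a ∈ U) :
    P M n m a = C (P M n m a).leadingCoeff * Lam (u a) := by
  have h1 := (IsAlgClosed.splits (P M n m a)).eq_prod_roots
  rw [(h.2 a ha).2.2.1, Multiset.map_map] at h1
  exact h1

theorem IsZeroBranch.eval_eq_zero {U : Set (Fin M → ℂ)} {u : (Fin M → ℂ) → Fin M → ℂ}
    (h : IsZeroBranch M n m U u) {a : Fin M → ℂ} (ha : a ∈ U) (i : Fin M) :
    (P M n m a).eval (u a i) = 0 := by
  rw [h.P_eq ha, eval_mul, Lam_eq_nodal, eval_nodal_at_node (Finset.mem_univ i), mul_zero]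

theorem IsZeroBranch.eval_derivative_ne_zero {U : Set (Fin M → ℂ)}
    {u : (Fin M → ℂ) → Fin M → ℂ} (h : IsZeroBranch M n m U u) {a : Fin M → ℂ} (ha : a ∈ U)
    (i : Fin M) : (P M n m a).derivative.eval (u a i) ≠ 0 := by
  rw [h.P_eq ha, derivative_C_mul, eval_mul, eval_C]
  exact mul_ne_zero (leadingCoeff_ne_zero.mpr (h.2 a ha).2.1)
    (eval_derivative_nodal_node_ne_zero (h.2 a ha).2.2.2.1 i)

theorem IsZeroBranch.differentiableAt {U : Set (Fin M → ℂ)} {u : (Fin M → ℂ) → Fin M → ℂ}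
    (hU : IsOpen U) (h : IsZeroBranch M n m U u) {a : Fin M → ℂ} (ha : a ∈ U) :
    DifferentiableAt ℂ u a := by
  rw [differentiableAt_pi]
  intro i
  obtain ⟨ψ, hψ, -, hiff⟩ := exists_implicitFunction
    (f := fun p : (Fin M → ℂ) × ℂ => (P M n m p.1).eval p.2) (x₀ := a) (z₀ := u a i)
    contDiff_eval_P.contDiffAt ((P M n m a).hasDerivAt (u a i)) (h.eval_derivative_ne_zero ha i)
  refine (hψ.differentiableAt one_ne_zero).congr_of_eventuallyEq ?_
  have hcont : ContinuousAt (fun x => (x, u x i)) a :=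
    continuousAt_id.prodMk
      ((continuous_apply i).continuousAt.comp (h.1.continuousAt (hU.mem_nhds ha)))
  filter_upwards [hcont.eventually hiff, hU.mem_nhds ha] with x hx hxU
  exact (hx.mp (by rw [h.eval_eq_zero hxU, h.eval_eq_zero ha])).symm

theorem hasDerivAt_update_of_differentiableAt {f : (Fin M → ℂ) → ℂ} {a : Fin M → ℂ}
    (hf : DifferentiableAt ℂ f a) (j : Fin M) :
    HasDerivAt (fun s => f (Function.update a j s)) (pd f j a) (a j) := by
  refine DifferentiableAt.hasDerivAt ?_
  have h1 : DifferentiableAt ℂ (fun s => Function.update a j s) (a j) :=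
    (hasDerivAt_update a j (a j)).differentiableAt
  have h2 : DifferentiableAt ℂ f (Function.update a j (a j)) := by
    rwa [Function.update_eq_self]
  exact h2.comp (a j) h1

theorem hasDerivAt_node_update (a : Fin M → ℂ) (j : Fin M) (l : Fin (M + 2)) :
    HasDerivAt (fun s => node (Function.update a j s) l)
      (if l = Fin.castAdd 2 j then 1 else 0) (a j) := by
  simp only [node_update]
  split_ifs
  · exact hasDerivAt_id' _
  · exact hasDerivAt_const _ _

/-- Since `∑ ∂_j b_l = 0`, each `1 / (z - a_l)` may be replaced by `1 / (z - a_l) - 1 / (z - a_j)`.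
Its numerator `a_l - a_j` cancels the Schlesinger denominator, and `h0` eliminates the remaining sum
of `b_l / (z - a_l)`. -/
theorem sum_pderiv_b_div (hn : 0 < n) (hm : 1 < m) (hdvd : m ∣ M + 2) {a : Fin M → ℂ}
    (ha : a ∈ config M) (j : Fin M) {z : ℂ} (hz : ∀ l, z ≠ node a l)
    (h0 : ∑ l, MvPolynomial.eval a (b M n m l) / (z - node a l) = 0) :
    ∑ l, MvPolynomial.eval a (MvPolynomial.pderiv j (b M n m l)) / (z - node a l) =
      MvPolynomial.eval a (b M n m (Fin.castAdd 2 j)) / (z - a j) *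
        ((n : ℂ) / m * ∑ l, 1 / (z - node a l)) := by
  have hzj : z - a j ≠ 0 := sub_ne_zero.mpr (by simpa using hz (Fin.castAdd 2 j))
  set J := Fin.castAdd 2 j with hJ
  have hJn : node a J = a j := node_castAdd a j
  have h1 : ∀ l ∈ Finset.univ.erase J,
      MvPolynomial.eval a (MvPolynomial.pderiv j (b M n m l)) / (z - node a l)
        - MvPolynomial.eval a (MvPolynomial.pderiv j (b M n m l)) / (z - a j) =
      (n : ℂ) / m / (z - a j) * (MvPolynomial.eval a (b M n m J) * (1 / (z - node a l))
        - MvPolynomial.eval a (b M n m l) / (z - node a l)) := by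
    intro l hl
    have hzl : z - node a l ≠ 0 := sub_ne_zero.mpr (hz l)
    have hlj : node a l - a j ≠ 0 := by
      rw [sub_ne_zero, ← hJn]
      exact fun h => Finset.ne_of_mem_erase hl (ha h)
    rw [eval_pderiv_b_of_ne ha (Finset.ne_of_mem_erase hl)]
    generalize MvPolynomial.eval a (b M n m l) = x
    generalize MvPolynomial.eval a (b M n m J) = y
    generalize (n : ℂ) / m = c
    field_simp
    ring
  have h2 := Finset.sum_congr rfl h1
  rw [Finset.sum_sub_distrib, ← Finset.mul_sum, Finset.sum_sub_distrib, ← Finset.mul_sum,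
    ← Finset.sum_div] at h2
  have h3 := eval_pderiv_b_self (n := n) hn hm hdvd a j
  rw [← Finset.add_sum_erase _ _ (Finset.mem_univ J)] at h0 ⊢
  rw [← Finset.add_sum_erase _ (fun l => 1 / (z - node a l)) (Finset.mem_univ J)]
  rw [← hJ] at h3
  rw [h3, hJn, neg_div]
  rw [hJn] at h0
  linear_combination h2 - (n : ℂ) / m / (z - a j) * h0

theorem IsZeroBranch.sum_div_eq_zero {U : Set (Fin M → ℂ)} {u : (Fin M → ℂ) → Fin M → ℂ}
    (h : IsZeroBranch M n m U u) {a : Fin M → ℂ} (ha : a ∈ U) (i : Fin M) :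
    ∑ l, MvPolynomial.eval a (b M n m l) / (u a i - node a l) = 0 := by
  have h1 := h.eval_eq_zero ha i
  rw [eval_P ((h.2 a ha).2.2.2.2 i)] at h1
  exact (mul_eq_zero.mp h1).resolve_left
    (eval_nodal_ne_zero _ _ fun l _ => (h.2 a ha).2.2.2.2 i l)

/-- Implicit differentiation of `∑ b_l / (u_i - a_l) = 0` gives `∂_j u_i` with factor `b_j / ∑ b_l /
(u_i - a_l)²`. Comparing `P_M = λ Λ` at `a_j`, and derivatives at `u_i`, turns this factor into
Okamoto's coefficient; `λ` cancels. -/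
theorem IsZeroBranch.pd_eq (hn : 0 < n) (hm : 1 < m) (hdvd : m ∣ M + 2) {U : Set (Fin M → ℂ)}
    {u : (Fin M → ℂ) → Fin M → ℂ} (hU : IsOpen U) (h : IsZeroBranch M n m U u) {a : Fin M → ℂ}
    (ha : a ∈ U) (i j : Fin M) :
    pd (fun x => u x i) j a = HCoeff j a (u a) i *
      ((n : ℂ) / m * ∑ l, 1 / (u a i - node a l) + 1 / (u a i - a j)) := by
  obtain ⟨hconf, hP0, -, hinj, hnode⟩ := h.2 a ha
  have hdiff : DifferentiableAt ℂ (fun x => u x i) a :=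
    differentiableAt_pi.mp (h.differentiableAt hU ha) i
  have hdu := hasDerivAt_update_of_differentiableAt hdiff j
  set u' := pd (fun x => u x i) j a with hu'
  set z := u a i with hz
  have hzj : z - a j ≠ 0 := sub_ne_zero.mpr (by simpa using hnode i (Fin.castAdd 2 j))
  have hd : HasDerivAt (fun s => ∑ l, MvPolynomial.eval (Function.update a j s) (b M n m l) /
      (u (Function.update a j s) i - node (Function.update a j s) l))
      (∑ l, (MvPolynomial.eval a (MvPolynomial.pderiv j (b M n m l)) * (z - node a l)
        - MvPolynomial.eval a (b M n m l) * (u' - if l = Fin.castAdd 2 j then 1 else 0))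
          / (z - node a l) ^ 2) (a j) := by
    refine HasDerivAt.fun_sum fun l _ => ?_
    have := (hasDerivAt_eval_update (b M n m l) a j).div
      (hdu.sub (hasDerivAt_node_update a j l)) (by
        simpa [sub_ne_zero] using hnode i l)
    simpa only [Pi.sub_apply, Function.update_eq_self] using! this
  have hzero : (fun s => ∑ l, MvPolynomial.eval (Function.update a j s) (b M n m l) /
      (u (Function.update a j s) i - node (Function.update a j s) l)) =ᶠ[𝓝 (a j)]
      fun _ => 0 := by
    have hc : ContinuousAt (fun s => Function.update a j s) (a j) :=
      (hasDerivAt_update a j (a j)).continuousAt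
    have hmem : ∀ᶠ s in 𝓝 (a j), Function.update a j s ∈ U :=
      hc.eventually (by simpa using hU.mem_nhds ha)
    filter_upwards [hmem] with s hs using h.sum_div_eq_zero hs i
  have h1 := hd.unique ((hasDerivAt_const (a j) (0 : ℂ)).congr_of_eventuallyEq hzero)
  have h2 : ∑ l, MvPolynomial.eval a (MvPolynomial.pderiv j (b M n m l)) / (z - node a l)
      + MvPolynomial.eval a (b M n m (Fin.castAdd 2 j)) / (z - a j) ^ 2
      - u' * ∑ l, MvPolynomial.eval a (b M n m l) / (z - node a l) ^ 2 = 0 := by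
    rw [← h1, Finset.mul_sum]
    have e : MvPolynomial.eval a (b M n m (Fin.castAdd 2 j)) / (z - a j) ^ 2 =
        ∑ l, (MvPolynomial.eval a (b M n m l) * if l = Fin.castAdd 2 j then 1 else 0)
          / (z - node a l) ^ 2 := by
      simp [ite_div]
    rw [e, ← Finset.sum_add_distrib, ← Finset.sum_sub_distrib]
    refine Finset.sum_congr rfl fun l _ => ?_
    have : z - node a l ≠ 0 := sub_ne_zero.mpr (hnode i l)
    field_simp
    ring
  have h0 := h.sum_div_eq_zero ha i
  rw [sum_pderiv_b_div hn hm hdvd hconf j (hnode i) h0] at h2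
  have hP' := eval_derivative_P (hnode i) h0
  have hPj := eval_P_node (n := n) (m := m) a (Fin.castAdd 2 j)
  rw [node_castAdd] at hPj
  have hlam : (P M n m a).leadingCoeff ≠ 0 := leadingCoeff_ne_zero.mpr hP0
  rw [h.P_eq ha, derivative_C_mul, eval_mul, eval_C] at hP'
  rw [h.P_eq ha, eval_mul, eval_C] at hPj
  have hT' : (derivative (T a)).eval (a j) ≠ 0 := by
    have := eval_derivative_nodal_node_ne_zero (x := node a) hconf (Fin.castAdd 2 j)
    rwa [node_castAdd] at this
  have hL' : (derivative (Lam (u a))).eval z ≠ 0 := eval_derivative_nodal_node_ne_zero hinj i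
  rw [HCoeff, ← hz]
  generalize MvPolynomial.eval a (b M n m (Fin.castAdd 2 j)) = β at *
  generalize (n : ℂ) / m * ∑ l, 1 / (z - node a l) = κ at *
  generalize ∑ l, MvPolynomial.eval a (b M n m l) / (z - node a l) ^ 2 = q at *
  generalize (P M n m a).leadingCoeff = lam at *
  have hβ : β = lam * (Lam (u a)).eval (a j) / (derivative (T a)).eval (a j) := by
    rw [hPj]; field_simp
  have key : u' * (lam * (derivative (Lam (u a))).eval z) =
      -((T a).eval z * (β / (z - a j) * (κ + 1 / (z - a j)))) := by
    have hsq : β / (z - a j) ^ 2 = β / (z - a j) * (1 / (z - a j)) := by field_simp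
    rw [hsq] at h2
    rw [hP']
    linear_combination (T a).eval z * h2
  rw [hβ] at key
  refine mul_right_cancel₀ (mul_ne_zero hlam hL') (key.trans ?_)
  field_simp

end

section

open Polynomial Lagrange
open scoped Topology

variable {M n m : ℕ}

/-! ### Branches of the zeros solve the Garnier system -/

/-- The indices `l` with `ε_l = 1`. -/
def posSet (ε : Fin (M + 2) → ℤˣ) : Finset (Fin (M + 2)) := Finset.univ.filter fun l => ε l = 1

theorem theta_eq_ite (ε : Fin (M + 2) → ℤˣ) (l : Fin (M + 2)) :
    theta n m ε l = if l ∈ posSet ε then (n : ℂ) / m else -((n : ℂ) / m) := by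
  rcases Int.units_eq_one_or (ε l) with h | h <;> simp [theta, posSet, h]

/-- A difference of squares, which factors because `∑ θ_l - 1 = 2c|S| + θ_∞`. -/
theorem kappa_theta (ε : Fin (M + 2) → ℤˣ) :
    kappa (theta n m ε) (thetaInf M n m) =
      (n : ℂ) / m * (posSet ε).card *
        ((n : ℂ) / m * (posSet ε).card - (n : ℂ) / m * (M + 2) - 1) := by
  have h : ∑ l, theta n m ε l =
      2 * ((n : ℂ) / m * (posSet ε).card) - (n : ℂ) / m * (M + 2) := by
    have h1 : ∀ l, theta n m ε l =
        2 * (if l ∈ posSet ε then (n : ℂ) / m else 0) - (n : ℂ) / m := by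
      intro l
      rw [theta_eq_ite]
      split_ifs <;> ring
    simp only [h1, Finset.sum_sub_distrib, ← Finset.mul_sum, Finset.sum_ite_mem]
    simp
    ring
  rw [kappa, h, thetaInf]
  ring

theorem vEps_eq_sum (ε : Fin (M + 2) → ℤˣ) (u : (Fin M → ℂ) → Fin M → ℂ) (a : Fin M → ℂ)
    (j : Fin M) :
    vEps n m ε u a j = ∑ l ∈ posSet ε, (n : ℂ) / m / (u a j - node a l) := by
  rw [vEps, posSet, Finset.sum_filter]
  refine Finset.sum_congr rfl fun l _ => ?_
  rcases Int.units_eq_one_or (ε l) with h | h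
  · simp only [h, Units.val_one, Int.cast_one, if_true]
    congr 1
    ring
  · simp [h]

theorem IsZeroBranch.isGarnierSolution (hn : 0 < n) (hm : 1 < m) (hdvd : m ∣ M + 2)
    {U : Set (Fin M → ℂ)} {u : (Fin M → ℂ) → Fin M → ℂ} (hU : IsOpen U)
    (h : IsZeroBranch M n m U u) (ε : Fin (M + 2) → ℤˣ) :
    IsGarnierSolution (theta n m ε) (thetaInf M n m) U u (vEps n m ε u) := by
  have hdu : ∀ a ∈ U, ∀ i, DifferentiableAt ℂ (fun x => u x i) a := fun a ha i =>
    differentiableAt_pi.mp (h.differentiableAt hU ha) i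
  have hnd : ∀ l, Differentiable ℂ fun a : Fin M → ℂ => node a l :=
    fun l => (contDiff_node (k := 1) l).differentiable one_ne_zero
  refine ⟨fun a ha => (h.differentiableAt hU ha).differentiableWithinAt, fun a ha => ?_,
    fun a ha => ?_⟩
  · refine DifferentiableAt.differentiableWithinAt (differentiableAt_pi.mpr fun i => ?_)
    simp only [vEps_eq_sum]
    refine DifferentiableAt.fun_sum fun l _ => ?_
    have h1 : DifferentiableAt ℂ (fun x => u x i - node x l) a := (hdu a ha i).fun_sub (hnd l a)
    have h2 : u a i - node a l ≠ 0 := sub_ne_zero.mpr ((h.2 a ha).2.2.2.2 i l)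
    simp only [div_eq_mul_inv _ (u _ _ - _)]
    exact (h1.fun_inv h2).const_mul _
  · obtain ⟨hconf, -, -, hinj, hnode⟩ := h.2 a ha
    refine ⟨hconf, hinj, hnode, fun i j => ?_⟩
    have hpu := h.pd_eq hn hm hdvd hU ha i j
    -- Termwise `(1 + ε_l) - ε_l = 1`, so the signs disappear.
    have hlin : (n : ℂ) / m * ∑ l, 1 / (u a i - node a l) + 1 / (u a i - a j) =
        2 * vEps n m ε u a i - HLin (theta n m ε) j a (u a i) := by
      have e : 1 / (u a i - a j) =
          ∑ l, (if l = Fin.castAdd 2 j then (1 : ℂ) else 0) / (u a i - node a l) := by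
        simp [ite_div]
      rw [vEps, HLin, e, Finset.mul_sum, Finset.mul_sum, ← Finset.sum_add_distrib,
        ← Finset.sum_sub_distrib]
      refine Finset.sum_congr rfl fun l _ => ?_
      rw [theta]
      ring
    rw [hlin] at hpu
    have hpv : pd (fun x => vEps n m ε u x i) j a =
        (if Fin.castAdd 2 j ∈ posSet ε then (n : ℂ) / m else 0) / (u a i - a j) ^ 2
          - pd (fun x => u x i) j a *
            ∑ l ∈ posSet ε, (n : ℂ) / m / (u a i - node a l) ^ 2 := by
      refine HasDerivAt.deriv ?_
      simp only [vEps_eq_sum]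
      have hd : HasDerivAt (fun s => ∑ l ∈ posSet ε, (n : ℂ) / m /
          (u (Function.update a j s) i - node (Function.update a j s) l))
          (∑ l ∈ posSet ε, (0 * (u a i - node a l) - (n : ℂ) / m *
            (pd (fun x => u x i) j a - if l = Fin.castAdd 2 j then 1 else 0))
            / (u a i - node a l) ^ 2) (a j) := by
        refine HasDerivAt.fun_sum fun l _ => ?_
        have := (hasDerivAt_const (a j) ((n : ℂ) / m)).div
          ((hasDerivAt_update_of_differentiableAt (hdu a ha i) j).sub
            (hasDerivAt_node_update a j l)) (by simpa [sub_ne_zero] using hnode i l)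
        simpa only [Pi.sub_apply, Function.update_eq_self] using! this
      refine hd.congr_deriv ?_
      have e : (if Fin.castAdd 2 j ∈ posSet ε then (n : ℂ) / m else 0) / (u a i - a j) ^ 2 =
          ∑ l ∈ posSet ε, ((n : ℂ) / m * if l = Fin.castAdd 2 j then 1 else 0)
            / (u a i - node a l) ^ 2 := by
        simp [ite_div]
      rw [e, Finset.mul_sum, ← Finset.sum_sub_distrib]
      refine Finset.sum_congr rfl fun l _ => ?_
      ring
    refine ⟨by rw [hpu, pd_H_right], ?_⟩
    rw [hpv, pd_H_left hconf j (theta_eq_ite ε) (kappa_theta ε) hinj hnode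
      (vEps_eq_sum ε u a) i, hpu]
    ring

/-! ### Algebraicity -/

/-- Evaluation of polynomials makes the functions on `U` an algebra over `ℂ[a_1, …, a_M]`. -/
abbrev evalAlgebra (U : Set (Fin M → ℂ)) : Algebra (MvPolynomial (Fin M) ℂ) (U → ℂ) :=
  (RingHom.pi fun a : U => MvPolynomial.eval a.1).toAlgebra

/-- Makes the closure of `IsAlgebraic` under sums, products and inverses available for functions on
`U`. -/
theorem isAlgebraicOn_iff (U : Set (Fin M → ℂ)) (f : (Fin M → ℂ) → ℂ) :
    letI := evalAlgebra U
    IsAlgebraicOn U f ↔ IsAlgebraic (MvPolynomial (Fin M) ℂ) fun a : U => f a := by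
  let _ := evalAlgebra U
  have h : ∀ (Q : Polynomial (MvPolynomial (Fin M) ℂ)) (a : U),
      aeval (fun a : U => f a) Q a = (Q.map (MvPolynomial.eval a.1)).eval (f a) := by
    intro Q a
    have := hom_eval₂ Q (algebraMap (MvPolynomial (Fin M) ℂ) (U → ℂ))
      (Pi.evalRingHom (fun _ : U => ℂ) a) fun a : U => f a
    rw [eval_map]
    exact this
  constructor
  · rintro ⟨Q, hQ, hz⟩
    refine ⟨Q, hQ, ?_⟩
    ext a
    rw [h]
    exact hz a a.2
  · rintro ⟨Q, hQ, hz⟩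
    refine ⟨Q, hQ, fun a ha => ?_⟩
    rw [← h Q ⟨a, ha⟩, hz]
    rfl

/-- The polynomial `P_M(z, a)` in the variables `a_1, …, a_M, z`. -/
def genericP (M n m : ℕ) : Polynomial (MvPolynomial (Fin M) ℂ) :=
  ∑ i, C (b M n m i) * nodal (Finset.univ.erase i) (node MvPolynomial.X)

theorem map_genericP (a : Fin M → ℂ) :
    (genericP M n m).map (MvPolynomial.eval a) = P M n m a := by
  have h : ∀ l, MvPolynomial.eval a (node MvPolynomial.X l) = node a l := fun l =>
    (map_node (MvPolynomial.eval a) MvPolynomial.X l).trans (by simp)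
  rw [genericP, P_eq_sum_nodal, Polynomial.map_sum]
  refine Finset.sum_congr rfl fun i _ => ?_
  rw [Polynomial.map_mul, map_C, nodal, nodal, Polynomial.map_prod]
  simp [h]

theorem IsZeroBranch.isAlgebraicOn {U : Set (Fin M → ℂ)} {u : (Fin M → ℂ) → Fin M → ℂ}
    (h : IsZeroBranch M n m U u) (j : Fin M) (ε : Fin (M + 2) → ℤˣ) :
    IsAlgebraicOn U (fun a => u a j) ∧ IsAlgebraicOn U (fun a => vEps n m ε u a j) := by
  let _ := evalAlgebra U
  rcases U.eq_empty_or_nonempty with rfl | ⟨a₀, ha₀⟩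
  · exact ⟨⟨1, one_ne_zero, by simp⟩, ⟨1, one_ne_zero, by simp⟩⟩
  have hu : IsAlgebraicOn U (fun a => u a j) := by
    refine ⟨genericP M n m, fun h0 => (h.2 a₀ ha₀).2.1 ?_, fun a ha => ?_⟩
    · rw [← map_genericP, h0, Polynomial.map_zero]
    · rw [map_genericP, h.eval_eq_zero ha]
  refine ⟨hu, ?_⟩
  rw [isAlgebraicOn_iff] at hu ⊢
  have hinv : ∀ l, IsAlgebraic (MvPolynomial (Fin M) ℂ)
      (fun a : U => (u a j - node a.1 l)⁻¹) := by
    intro l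
    have h1 : IsAlgebraic (MvPolynomial (Fin M) ℂ) (fun a : U => u a j - node a.1 l) := by
      have h2 := hu.sub (isAlgebraic_algebraMap (R := MvPolynomial (Fin M) ℂ) (A := U → ℂ)
        (node MvPolynomial.X l))
      convert! h2 using 1
      ext a
      have := map_node (MvPolynomial.eval a.1) MvPolynomial.X l
      simp only [MvPolynomial.eval_X] at this
      change u a j - node a.1 l = u a j - MvPolynomial.eval a.1 (node MvPolynomial.X l)
      rw [this]
    -- `U → ℂ` is not a field; the difference is a unit because it vanishes nowhere on `U`.
    let : Invertible (fun a : U => u a j - node a.1 l) :=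
      ⟨fun a : U => (u a j - node a.1 l)⁻¹,
        funext fun a => inv_mul_cancel₀ (sub_ne_zero.mpr ((h.2 a a.2).2.2.2.2 j l)),
        funext fun a => mul_inv_cancel₀ (sub_ne_zero.mpr ((h.2 a a.2).2.2.2.2 j l))⟩
    exact h1.invOf
  have hsum : IsAlgebraic (MvPolynomial (Fin M) ℂ) (∑ l ∈ posSet ε,
      algebraMap (MvPolynomial (Fin M) ℂ) (U → ℂ) (MvPolynomial.C ((n : ℂ) / m)) *
        fun a : U => (u a j - node a.1 l)⁻¹) :=
    Finset.sum_induction _ (IsAlgebraic (MvPolynomial (Fin M) ℂ)) (fun _ _ hx hy => hx.add hy)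
      isAlgebraic_zero fun l _ => (isAlgebraic_algebraMap _).mul (hinv l)
  convert! hsum using 1
  ext a
  rw [vEps_eq_sum, Finset.sum_apply]
  refine Finset.sum_congr rfl fun l _ => ?_
  change _ = MvPolynomial.eval a.1 (MvPolynomial.C ((n : ℂ) / m)) * _
  rw [MvPolynomial.eval_C, div_eq_mul_inv]

end

section

open Polynomial Lagrange
open scoped Topology

variable {M n m : ℕ}

/-! ### Generic simplicity of the zeros -/

theorem exists_roots_eq_map {p : ℂ[X]} {k : ℕ} (hp : p.Separable) (hk : p.natDegree = k) :
    ∃ z : Fin k → ℂ, Function.Injective z ∧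
      p.roots = (Finset.univ : Finset (Fin k)).val.map z := by
  classical
  have hnd : p.roots.Nodup := nodup_roots hp
  have hcard : p.roots.toFinset.card = k := by
    rw [Multiset.toFinset_card_of_nodup hnd, ← hk]
    exact (IsAlgClosed.splits p).natDegree_eq_card_roots.symm
  let e := Finset.equivFinOfCardEq hcard
  have hinj : Function.Injective fun i => (e.symm i : ℂ) :=
    Subtype.val_injective.comp e.symm.injective
  refine ⟨fun i => e.symm i, hinj, ?_⟩
  rw [Multiset.Nodup.ext hnd (Multiset.Nodup.map hinj Finset.univ.nodup)]
  intro z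
  simp only [Multiset.mem_map, Finset.mem_val, Finset.mem_univ, true_and]
  constructor
  · intro hz
    exact ⟨e ⟨z, Multiset.mem_toFinset.mpr hz⟩, by simp⟩
  · rintro ⟨i, rfl⟩
    exact Multiset.mem_toFinset.mp (e.symm i).2

theorem roots_eq_map_of_injective {p : ℂ[X]} {k : ℕ} (hp : p ≠ 0) (hk : p.natDegree ≤ k)
    {z : Fin k → ℂ} (hz : Function.Injective z) (h : ∀ i, p.eval (z i) = 0) :
    p.roots = (Finset.univ : Finset (Fin k)).val.map z := by
  refine (Multiset.eq_of_le_of_card_le ?_ ?_).symm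
  · rw [Multiset.le_iff_subset (Multiset.Nodup.map hz Finset.univ.nodup)]
    intro w hw
    obtain ⟨i, -, rfl⟩ := Multiset.mem_map.mp hw
    exact (mem_roots hp).mpr (h i)
  · simpa using (card_roots' p).trans hk

/-- Simple zeros of `f(x₀, ·)` extend to continuous families of zeros. -/
theorem exists_continuous_roots {E : Type*} [NormedAddCommGroup E] [NormedSpace ℂ E]
    [CompleteSpace E] {f : E × ℂ → ℂ} {x₀ : E} {k : ℕ} {z f' : Fin k → ℂ}
    (hf : ∀ i, ContDiffAt ℂ 1 f (x₀, z i)) (hz : ∀ i, f (x₀, z i) = 0)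
    (hf' : ∀ i, HasDerivAt (fun w => f (x₀, w)) (f' i) (z i)) (h0 : ∀ i, f' i ≠ 0) :
    ∃ ψ : E → Fin k → ℂ, ψ x₀ = z ∧
      ∀ᶠ x in 𝓝 x₀, ContinuousAt ψ x ∧ ∀ i, f (x, ψ x i) = 0 := by
  choose ψ hψ hψ0 hiff using fun i => exists_implicitFunction (hf i) (hf' i) (h0 i)
  refine ⟨fun x i => ψ i x, funext hψ0, ?_⟩
  have h1 : ∀ᶠ x in 𝓝 x₀, ∀ i, ContinuousAt (ψ i) x := by
    refine Filter.eventually_all.mpr fun i => ?_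
    filter_upwards [(hψ i).eventually (by simp)] with x hx using hx.continuousAt
  have h2 : ∀ᶠ x in 𝓝 x₀, ∀ i, f (x, ψ i x) = 0 := by
    refine Filter.eventually_all.mpr fun i => ?_
    have hc : ContinuousAt (fun x => (x, ψ i x)) x₀ :=
      continuousAt_id.prodMk (hψ i).continuousAt
    have hi := hiff i
    rw [← hψ0 i] at hi
    filter_upwards [hc.eventually hi] with x hx
    rw [hx.mpr rfl, hψ0, hz]
  filter_upwards [h1, h2] with x hx1 hx2
  exact ⟨continuousAt_pi.mpr hx1, hx2⟩

theorem eventually_ne_of_continuousAt {X : Type*} [TopologicalSpace X] {f g : X → ℂ} {x₀ : X}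
    (hf : ContinuousAt f x₀) (hg : ContinuousAt g x₀) (h : f x₀ ≠ g x₀) :
    ∀ᶠ x in 𝓝 x₀, f x ≠ g x := by
  filter_upwards [(hf.sub hg).eventually_ne (y := 0) (sub_ne_zero.mpr h)] with x hx
  exact sub_ne_zero.mp hx

theorem eventually_injective {X ι : Type*} [TopologicalSpace X] [Finite ι] {ψ : X → ι → ℂ}
    {x₀ : X} (hψ : ContinuousAt ψ x₀) (h : Function.Injective (ψ x₀)) :
    ∀ᶠ x in 𝓝 x₀, Function.Injective (ψ x) := by
  have : ∀ᶠ x in 𝓝 x₀, ∀ i j, i ≠ j → ψ x i ≠ ψ x j := by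
    refine Filter.eventually_all.mpr fun i => Filter.eventually_all.mpr fun j => ?_
    by_cases hij : i = j
    · simp [hij]
    · filter_upwards [eventually_ne_of_continuousAt (continuousAt_pi.mp hψ i)
        (continuousAt_pi.mp hψ j) fun e => hij (h e)] with x hx _ using hx
  filter_upwards [this] with x hx i j hij
  by_contra hne
  exact hx i j hne hij

/-- The coefficient of `z^(M+1)` is `∑ b_i = 0`. -/
theorem natDegree_genericP_le (hn : 0 < n) (hm : 1 < m) (hdvd : m ∣ M + 2) :
    (genericP M n m).natDegree ≤ M := by
  have hd : ∀ i : Fin (M + 2), (nodal (Finset.univ.erase i)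
      (node (MvPolynomial.X (R := ℂ) : Fin M → MvPolynomial (Fin M) ℂ))).natDegree = M + 1 := by
    intro i
    rw [natDegree_nodal, Finset.card_erase_of_mem (Finset.mem_univ i)]
    simp
  rw [natDegree_le_iff_coeff_eq_zero]
  intro k hk
  rw [genericP, finsetSum_coeff]
  rcases (Nat.succ_le_of_lt hk).eq_or_lt with rfl | hk
  · rw [← sum_b (M := M) hn hm hdvd]
    refine Finset.sum_congr rfl fun i _ => ?_
    have h1 : (nodal (Finset.univ.erase i) (node (MvPolynomial.X (R := ℂ) :
        Fin M → MvPolynomial (Fin M) ℂ))).leadingCoeff = 1 := nodal_monic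
    rw [leadingCoeff, hd i] at h1
    rw [coeff_C_mul, Nat.succ_eq_add_one, h1, mul_one]
  · refine Finset.sum_eq_zero fun i _ => ?_
    rw [coeff_C_mul, coeff_eq_zero_of_natDegree_lt (by rw [hd i]; exact hk), mul_zero]

theorem natDegree_P_le (hn : 0 < n) (hm : 1 < m) (hdvd : m ∣ M + 2) (a : Fin M → ℂ) :
    (P M n m a).natDegree ≤ M := by
  rw [← map_genericP]
  exact natDegree_map_le.trans (natDegree_genericP_le hn hm hdvd)

theorem coeff_P (a : Fin M → ℂ) (k : ℕ) :
    (P M n m a).coeff k = MvPolynomial.eval a ((genericP M n m).coeff k) := by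
  rw [← map_genericP, coeff_map]

/-- Fixing the formal degrees `M` and `M - 1` lets the resultant commute with evaluation; `hdeg`
makes them the true degrees. -/
theorem eval_resultant_ne_zero_iff (hM : 0 < M) {a : Fin M → ℂ}
    (hdeg : (P M n m a).natDegree = M) :
    MvPolynomial.eval a
      ((genericP M n m).resultant (derivative (genericP M n m)) M (M - 1)) ≠ 0 ↔
        (P M n m a).Separable := by
  have h1 := resultant_map_map (genericP M n m) (derivative (genericP M n m)) M (M - 1)
    (MvPolynomial.eval a)
  rw [← derivative_map, map_genericP] at h1
  have hP : P M n m a ≠ 0 := by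
    intro h
    rw [h, natDegree_zero] at hdeg
    lia
  have h2 : (derivative (P M n m a)).natDegree = M - 1 := by
    rw [natDegree_derivative, hdeg]
  have h3 := resultant_eq_zero_iff (f := P M n m a) (g := derivative (P M n m a))
  rw [hdeg, h2] at h3
  rw [← h1, Ne, h3, separable_def]
  simp [hP]

/-! ### The degeneration `a → 0`. -/

theorem node_castSucc (a : Fin M → ℂ) (l : Fin (M + 1)) :
    node a l.castSucc = (Fin.snoc a 0 : Fin (M + 1) → ℂ) l := by
  refine Fin.lastCases ?_ (fun i => ?_) l
  · rw [Fin.snoc_last]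
    exact (node_natAdd a 0).trans (by simp)
  · rw [Fin.snoc_castSucc]
    exact node_castAdd a i

theorem node_last (a : Fin M → ℂ) : node a (Fin.last (M + 1)) = 1 :=
  (node_natAdd a 1).trans (by simp)

theorem eval_zero_b_castSucc (l : Fin (M + 1)) :
    MvPolynomial.eval 0 (b M n m l.castSucc) =
      Ring.choose ((n : ℂ) / m) ((M + 2) / m * n) :=
  eval_zero_b _ fun h => by
    have := congrArg Fin.val h
    have := l.2
    simp at *
    lia

theorem eval_zero_b_ne_zero (hn : 0 < n) (hm : 1 < m) (hnm : Nat.Coprime n m)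
    (hdvd : m ∣ M + 2) (i : Fin (M + 2)) : MvPolynomial.eval 0 (b M n m i) ≠ 0 := by
  have hc := choose_ne_zero (natCast_div_ne_natCast hm hnm) ((M + 2) / m * n)
  refine Fin.lastCases ?_ (fun l => ?_) i
  · have h := sum_eval_b (n := n) hn hm hdvd (0 : Fin M → ℂ)
    rw [Fin.sum_univ_castSucc] at h
    simp only [eval_zero_b_castSucc] at h
    intro h0
    rw [h0, add_zero, Finset.sum_const, Finset.card_univ, Fintype.card_fin, nsmul_eq_mul] at h
    exact mul_ne_zero (by exact_mod_cast Nat.succ_ne_zero M) hc h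
  · rw [eval_zero_b_castSucc]
    exact hc

theorem b_ne_zero (hn : 0 < n) (hm : 1 < m) (hnm : Nat.Coprime n m)
    (hdvd : m ∣ M + 2) (i : Fin (M + 2)) : b M n m i ≠ 0 := fun h =>
  eval_zero_b_ne_zero hn hm hnm hdvd i (by rw [h, map_zero])

/-- The roots of `X ^ (M + 1) - X` are `0` and the `M`-th roots of unity. -/
theorem exists_nodal_eq_X_pow_sub_X (hM : 0 < M) :
    ∃ x : Fin M → ℂ,
      nodal Finset.univ (Fin.snoc x 0 : Fin (M + 1) → ℂ) = X ^ (M + 1) - X := by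
  have hsep : (X ^ M - C (1 : ℂ)).Separable :=
    separable_X_pow_sub_C _ (by exact_mod_cast hM.ne') one_ne_zero
  obtain ⟨x, -, hx⟩ := exists_roots_eq_map hsep (natDegree_X_pow_sub_C)
  refine ⟨x, ?_⟩
  have h1 := (IsAlgClosed.splits (X ^ M - C (1 : ℂ))).eq_prod_roots
  rw [hx, leadingCoeff_X_pow_sub_C hM, C_1, one_mul, Multiset.map_map] at h1
  rw [nodal, Fin.prod_univ_castSucc]
  simp only [Fin.snoc_castSucc, Fin.snoc_last, C_0, sub_zero]
  have h2 : ∏ i, (X - C (x i)) = X ^ M - (1 : ℂ[X]) := h1.symm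
  rw [h2]
  ring

/-- Up to a factor, `P_M(e ζ, e x)`, as a function of `e` and `ζ` that is regular at `e = 0`. -/
def rescaledP (n m : ℕ) (x : Fin M → ℂ) (p : ℂ × ℂ) : ℂ :=
  ∑ l : Fin (M + 1), MvPolynomial.eval (p.1 • x) (b M n m l.castSucc)
      * (p.2 - (Fin.snoc x 0 : Fin (M + 1) → ℂ) l)⁻¹
    + MvPolynomial.eval (p.1 • x) (b M n m (Fin.last (M + 1))) * (p.1 * (p.1 * p.2 - 1)⁻¹)

theorem snoc_smul_zero (e : ℂ) (x : Fin M → ℂ) (l : Fin (M + 1)) :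
    (Fin.snoc (e • x) 0 : Fin (M + 1) → ℂ) l = e * (Fin.snoc x 0 : Fin (M + 1) → ℂ) l := by
  refine Fin.lastCases ?_ (fun i => ?_) l
  · simp
  · simp

theorem eval_P_eq_zero_of_rescaledP {x : Fin M → ℂ} {e z : ℂ} (he : e ≠ 0)
    (hz : ∀ l, z ≠ (Fin.snoc x 0 : Fin (M + 1) → ℂ) l) (hez : e * z ≠ 1)
    (h : rescaledP n m x (e, z) = 0) : (P M n m (e • x)).eval (e * z) = 0 := by
  have hnode : ∀ l, e * z ≠ node (e • x) l := by
    intro l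
    refine Fin.lastCases ?_ (fun i => ?_) l
    · rwa [node_last]
    · rw [node_castSucc, snoc_smul_zero]
      exact fun h => hz i (mul_left_cancel₀ he h)
  rw [eval_P hnode, Fin.sum_univ_castSucc, node_last]
  simp only [node_castSucc, snoc_smul_zero]
  have h2 : ∑ l : Fin (M + 1), MvPolynomial.eval (e • x) (b M n m l.castSucc)
      / (e * z - e * (Fin.snoc x 0 : Fin (M + 1) → ℂ) l)
      + MvPolynomial.eval (e • x) (b M n m (Fin.last (M + 1))) / (e * z - 1) =
        e⁻¹ * rescaledP n m x (e, z) := by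
    rw [rescaledP, mul_add, Finset.mul_sum]
    congr 1
    · refine Finset.sum_congr rfl fun l _ => ?_
      rw [← mul_sub, div_eq_mul_inv, mul_inv]
      ring
    · field_simp
  rw [h2, h, mul_zero, mul_zero]

theorem contDiffAt_rescaledP (x : Fin M → ℂ) {z : ℂ}
    (hz : ∀ l, z ≠ (Fin.snoc x 0 : Fin (M + 1) → ℂ) l) :
    ContDiffAt ℂ 1 (rescaledP n m x) (0, z) := by
  have hb : ∀ i, ContDiffAt ℂ 1 (fun p : ℂ × ℂ => MvPolynomial.eval (p.1 • x) (b M n m i))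
      (0, z) := fun i =>
    ((contDiff_eval (k := 1) (b M n m i)).comp (contDiff_fst.smul contDiff_const)).contDiffAt
  unfold rescaledP
  refine ContDiffAt.add (ContDiffAt.sum fun l _ => (hb _).mul ?_) ((hb _).mul ?_)
  · exact (contDiffAt_snd.sub contDiffAt_const).inv (sub_ne_zero.mpr (hz l))
  · refine contDiffAt_fst.mul (((contDiffAt_fst.mul contDiffAt_snd).sub contDiffAt_const).inv ?_)
    simp

/-- For `a = e x` and `z = e ζ` the equation becomes, at `e = 0`, `β τ'(ζ) / τ(ζ) = 0` with `τ =
X^(M+1) - X`: the node `1` escapes to infinity and the other residues equal `β ≠ 0`. The `M` simple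
zeros of `τ'` persist for small `e ≠ 0` and exhaust the degree of `P_M`. -/
theorem exists_natDegree_P_eq_and_separable (hM : 0 < M) (hn : 0 < n) (hm : 1 < m)
    (hnm : Nat.Coprime n m) (hdvd : m ∣ M + 2) :
    ∃ a : Fin M → ℂ, (P M n m a).natDegree = M ∧ (P M n m a).Separable := by
  obtain ⟨x, hx⟩ := exists_nodal_eq_X_pow_sub_X hM
  set y : Fin (M + 1) → ℂ := Fin.snoc x 0 with hy
  set β := Ring.choose ((n : ℂ) / m) ((M + 2) / m * n) with hβ
  have hβ0 : β ≠ 0 := choose_ne_zero (natCast_div_ne_natCast hm hnm) _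
  have hM0 : (M : ℂ) ≠ 0 := by exact_mod_cast hM.ne'
  have hM1 : (M : ℂ) + 1 ≠ 0 := by exact_mod_cast Nat.succ_ne_zero M
  have hsep : (X ^ M - C (((M : ℂ) + 1)⁻¹)).Separable :=
    separable_X_pow_sub_C _ hM0 (inv_ne_zero hM1)
  obtain ⟨z, hzinj, hz⟩ := exists_roots_eq_map hsep natDegree_X_pow_sub_C
  have hzM : ∀ k, z k ^ M = ((M : ℂ) + 1)⁻¹ := by
    intro k
    have h1 : z k ∈ (X ^ M - C (((M : ℂ) + 1)⁻¹)).roots := by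
      rw [hz]
      exact Multiset.mem_map_of_mem z (Finset.mem_univ k)
    have h2 := (mem_roots'.mp h1).2
    simpa [sub_eq_zero] using h2
  have hz0 : ∀ k, z k ≠ 0 := by
    intro k h
    have := hzM k
    rw [h, zero_pow hM.ne'] at this
    exact inv_ne_zero hM1 this.symm
  have hτ : ∀ k, (nodal Finset.univ y).eval (z k) ≠ 0 := by
    intro k h
    rw [hx] at h
    simp only [eval_sub, eval_pow, eval_X] at h
    rw [pow_succ, hzM] at h
    have h1 : (((M : ℂ) + 1)⁻¹ - 1) * z k = 0 := by linear_combination h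
    rcases mul_eq_zero.mp h1 with h2 | h2
    · field_simp at h2
      exact hM0 (by linear_combination -h2)
    · exact hz0 k h2
  have hzy : ∀ k l, z k ≠ y l := by
    intro k l h
    refine hτ k ?_
    rw [h]
    exact eval_nodal_at_node (Finset.mem_univ l)
  have hτ' : ∀ k, (derivative (nodal Finset.univ y)).eval (z k) = 0 := by
    intro k
    rw [hx]
    simp [hzM, hM1]
  have hf : ∀ w, (∀ l, w ≠ y l) → rescaledP n m x (0, w) =
      β * ((derivative (nodal Finset.univ y)).eval w / (nodal Finset.univ y).eval w) := by
    intro w hw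
    have h1 : (nodal Finset.univ y).eval w ≠ 0 := eval_nodal_ne_zero _ _ fun l _ => hw l
    rw [eval_derivative_nodal _ _ fun l _ => hw l, mul_div_cancel_left₀ _ h1, rescaledP,
      Finset.mul_sum]
    simp only [zero_smul, eval_zero_b_castSucc, zero_mul, mul_zero, add_zero, one_div, hβ, hy]
  obtain ⟨ψ, hψ0, hψ⟩ := exists_continuous_roots (f := rescaledP n m x) (x₀ := 0) (z := z)
    (f' := fun k => β * ((derivative (derivative (nodal Finset.univ y))).eval (z k) /
      (nodal Finset.univ y).eval (z k)))
    (fun k => contDiffAt_rescaledP x (hzy k))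
    (fun k => by rw [hf _ (hzy k), hτ' k]; simp)
    (fun k => by
      have h1 := (((derivative (nodal Finset.univ y)).hasDerivAt (z k)).div
        ((nodal Finset.univ y).hasDerivAt (z k)) (hτ k)).const_mul β
      have h2 : ∀ᶠ w in 𝓝 (z k), ∀ l, w ≠ y l :=
        Filter.eventually_all.mpr fun l => isOpen_ne.mem_nhds (hzy k l)
      refine (h1.congr_deriv ?_).congr_of_eventuallyEq ?_
      · rw [hτ' k]
        have := hτ k
        field_simp
        ring
      · filter_upwards [h2] with w hw
        exact hf w hw)
    (fun k => by
      refine mul_ne_zero hβ0 (div_ne_zero ?_ (hτ k))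
      have h2 : derivative (derivative (X ^ (M + 1) - X : ℂ[X])) =
          C (((M : ℂ) + 1) * M) * X ^ (M - 1) := by
        rw [derivative_sub, derivative_X_pow, derivative_X, derivative_sub, derivative_one,
          sub_zero, Nat.add_sub_cancel, derivative_C_mul, derivative_X_pow, C_mul]
        push_cast
        ring
      rw [hx, h2, eval_mul, eval_C, eval_pow, eval_X]
      exact mul_ne_zero (mul_ne_zero hM1 hM0) (pow_ne_zero _ (hz0 k)))
  have hψc : ContinuousAt ψ 0 := hψ.self_of_nhds.1
  have e1 : ∀ᶠ e in 𝓝 (0 : ℂ), Function.Injective (ψ e) :=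
    eventually_injective hψc (hψ0 ▸ hzinj)
  have e2 : ∀ᶠ e in 𝓝 (0 : ℂ), ∀ k l, ψ e k ≠ y l :=
    Filter.eventually_all.mpr fun k => Filter.eventually_all.mpr fun l =>
      (continuousAt_pi.mp hψc k).eventually_ne (by rw [hψ0]; exact hzy k l)
  have e3 : ∀ᶠ e in 𝓝 (0 : ℂ), ∀ k, e * ψ e k ≠ 1 :=
    Filter.eventually_all.mpr fun k =>
      (continuousAt_id.mul (continuousAt_pi.mp hψc k)).eventually_ne (by simp)
  have e4 : ∀ᶠ e in 𝓝 (0 : ℂ),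
      MvPolynomial.eval (e • x) (b M n m (Fin.last (M + 1))) ≠ 0 := by
    have hc : Continuous fun e : ℂ => MvPolynomial.eval (e • x) (b M n m (Fin.last (M + 1))) :=
      (contDiff_eval (k := 1) _).continuous.comp (continuous_id.smul continuous_const)
    refine hc.continuousAt.eventually_ne ?_
    rw [zero_smul]
    exact eval_zero_b_ne_zero hn hm hnm hdvd _
  have e5 : ∀ᶠ e in 𝓝 (0 : ℂ), ∀ l, (1 : ℂ) ≠ e * y l :=
    Filter.eventually_all.mpr fun l =>
      ((continuousAt_id.mul continuousAt_const).eventually_ne (by simp)).mono fun e he => he.symm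
  -- The punctured neighbourhood is needed to undo the scaling by `e`.
  have hall : ∀ᶠ e in 𝓝[≠] (0 : ℂ), (Function.Injective (ψ e) ∧ (∀ k l, ψ e k ≠ y l) ∧
      (∀ k, e * ψ e k ≠ 1) ∧ MvPolynomial.eval (e • x) (b M n m (Fin.last (M + 1))) ≠ 0 ∧
      (∀ l, (1 : ℂ) ≠ e * y l) ∧ ∀ k, rescaledP n m x (e, ψ e k) = 0) ∧ e ≠ 0 := by
    refine Filter.Eventually.and (Filter.Eventually.filter_mono nhdsWithin_le_nhds ?_)
      self_mem_nhdsWithin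
    filter_upwards [e1, e2, e3, e4, e5, hψ] with e h1 h2 h3 h4 h5 h6
    exact ⟨h1, h2, h3, h4, h5, h6.2⟩
  obtain ⟨e, ⟨h1, h2, h3, h4, h5, h6⟩, he⟩ := hall.exists
  -- The value of `P_M` at the node `1` is a nonzero residue times `T'(1)`, and `1` differs from all
  -- other nodes.
  have hP : P M n m (e • x) ≠ 0 := by
    intro h
    have h7 := eval_P_node (n := n) (m := m) (e • x) (Fin.last (M + 1))
    rw [h, eval_zero, eq_comm, T_eq_nodal,
      eval_nodal_derivative_eval_node_eq (Finset.mem_univ _)] at h7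
    refine mul_ne_zero h4 (eval_nodal_ne_zero _ _ fun l hl => ?_) h7
    rw [node_last]
    revert hl
    refine Fin.lastCases ?_ (fun i => ?_) l
    · simp
    · intro _
      rw [node_castSucc, snoc_smul_zero]
      exact h5 i
  have hroots := roots_eq_map_of_injective hP (natDegree_P_le hn hm hdvd _)
    (z := fun k => e * ψ e k) (fun k l hkl => h1 (mul_left_cancel₀ he hkl))
    fun k => eval_P_eq_zero_of_rescaledP he (h2 k) (h3 k) (h6 k)
  refine ⟨e • x, ?_, ?_⟩
  · rw [(IsAlgClosed.splits (P M n m (e • x))).natDegree_eq_card_roots, hroots]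
    simp
  · rw [← nodup_roots_iff_of_splits hP (IsAlgClosed.splits _), hroots]
    exact Multiset.Nodup.map (fun k l hkl => h1 (mul_left_cancel₀ he hkl)) Finset.univ.nodup

/-! ### The exceptional polynomial and local branches of zeros. -/

/-- The polynomial outside whose zero set `P_M(·, a)` has `M` simple zeros, none of them an
`a_i`. -/
def genericity (M n m : ℕ) : MvPolynomial (Fin M) ℂ :=
  (genericP M n m).resultant (derivative (genericP M n m)) M (M - 1) *
    (genericP M n m).coeff M * ∏ i, b M n m i

theorem genericity_ne_zero (hM : 0 < M) (hn : 0 < n) (hm : 1 < m) (hnm : Nat.Coprime n m)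
    (hdvd : m ∣ M + 2) : genericity M n m ≠ 0 := by
  obtain ⟨a, hdeg, hsep⟩ := exists_natDegree_P_eq_and_separable hM hn hm hnm hdvd
  refine mul_ne_zero (mul_ne_zero ?_ ?_)
    (Finset.prod_ne_zero_iff.mpr fun i _ => b_ne_zero hn hm hnm hdvd i)
  · intro h
    exact (eval_resultant_ne_zero_iff hM hdeg).mpr hsep (by rw [h, map_zero])
  · intro h
    have h1 : (P M n m a).leadingCoeff = 0 := by
      rw [leadingCoeff, hdeg, coeff_P, h, map_zero]
    rw [leadingCoeff_eq_zero] at h1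
    rw [h1, natDegree_zero] at hdeg
    lia

/-- Of the factors of `genericity`, the coefficient of `z^M` fixes the number of zeros, the
resultant makes them simple, and the `b_i` keep them off the nodes. The implicit function theorem
continues the zeros, and all these conditions are open. -/
theorem exists_isZeroBranch (hM : 0 < M) (hn : 0 < n) (hm : 1 < m) (hdvd : m ∣ M + 2)
    {a₀ : Fin M → ℂ} (ha₀ : a₀ ∈ config M) (h : MvPolynomial.eval a₀ (genericity M n m) ≠ 0) :
    ∃ r > 0, ∃ u : (Fin M → ℂ) → Fin M → ℂ, IsZeroBranch M n m (Metric.ball a₀ r) u := by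
  rw [genericity, map_mul, map_mul, map_prod] at h
  have hb : ∀ i, MvPolynomial.eval a₀ (b M n m i) ≠ 0 := fun i =>
    Finset.prod_ne_zero_iff.mp (right_ne_zero_of_mul h) i (Finset.mem_univ i)
  have hlead := right_ne_zero_of_mul (left_ne_zero_of_mul h)
  have hres := left_ne_zero_of_mul (left_ne_zero_of_mul h)
  have hdeg : (P M n m a₀).natDegree = M :=
    natDegree_eq_of_le_of_coeff_ne_zero (natDegree_P_le hn hm hdvd a₀) (by rwa [coeff_P])
  have hsep := (eval_resultant_ne_zero_iff hM hdeg).mp hres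
  obtain ⟨z, hzinj, hz⟩ := exists_roots_eq_map hsep hdeg
  have hroot : ∀ k, (P M n m a₀).eval (z k) = 0 := fun k =>
    (mem_roots'.mp (hz ▸ Multiset.mem_map_of_mem z (Finset.mem_univ k))).2
  have hder : ∀ k, (P M n m a₀).derivative.eval (z k) ≠ 0 := fun k =>
    hsep.eval₂_derivative_ne_zero (RingHom.id ℂ) (hroot k)
  have hzn : ∀ k l, z k ≠ node a₀ l := by
    intro k l hkl
    have h1 := hroot k
    rw [hkl, eval_P_node] at h1
    exact mul_ne_zero (hb l) (eval_derivative_nodal_node_ne_zero ha₀ l) h1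
  obtain ⟨ψ, hψ0, hψ⟩ := exists_continuous_roots
    (f := fun p : (Fin M → ℂ) × ℂ => (P M n m p.1).eval p.2) (x₀ := a₀) (z := z)
    (fun k => contDiff_eval_P.contDiffAt) hroot (fun k => (P M n m a₀).hasDerivAt (z k)) hder
  have hψc : ContinuousAt ψ a₀ := hψ.self_of_nhds.1
  have hnc : Continuous fun a : Fin M → ℂ => node a :=
    continuous_pi fun l => (contDiff_node (k := 1) l).continuous
  have e1 : ∀ᶠ a in 𝓝 a₀, Function.Injective (ψ a) :=
    eventually_injective hψc (hψ0 ▸ hzinj)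
  have e2 : ∀ᶠ a in 𝓝 a₀, Function.Injective (node a) :=
    eventually_injective hnc.continuousAt ha₀
  have e3 : ∀ᶠ a in 𝓝 a₀, ∀ k l, ψ a k ≠ node a l := by
    refine Filter.eventually_all.mpr fun k => Filter.eventually_all.mpr fun l => ?_
    have hl : ContinuousAt (fun a : Fin M → ℂ => node a l) a₀ :=
      continuousAt_pi.mp hnc.continuousAt l
    exact eventually_ne_of_continuousAt (continuousAt_pi.mp hψc k) hl
      (by rw [hψ0]; exact hzn k l)
  have e4 : ∀ᶠ a in 𝓝 a₀, MvPolynomial.eval a ((genericP M n m).coeff M) ≠ 0 :=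
    (contDiff_eval (k := 1) _).continuous.continuousAt.eventually_ne hlead
  obtain ⟨r, hr, hball⟩ := Metric.eventually_nhds_iff_ball.mp
    (e1.and (e2.and (e3.and (e4.and hψ))))
  refine ⟨r, hr, ψ, fun a ha => ((hball a ha).2.2.2.2.1).continuousWithinAt, fun a ha => ?_⟩
  obtain ⟨h1, h2, h3, h4, -, h5⟩ := hball a ha
  have hP : P M n m a ≠ 0 := by
    intro h0
    rw [← coeff_P, h0, coeff_zero] at h4
    exact h4 rfl
  exact ⟨h2, hP, roots_eq_map_of_injective hP (natDegree_P_le hn hm hdvd a) h1 h5, h1, h3⟩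

theorem IsZeroBranch.isAlgebraicGarnierSolution (hn : 0 < n) (hm : 1 < m) (hdvd : m ∣ M + 2)
    {U : Set (Fin M → ℂ)} {u : (Fin M → ℂ) → Fin M → ℂ} (hU : IsOpen U)
    (h : IsZeroBranch M n m U u) (ε : Fin (M + 2) → ℤˣ) :
    IsAlgebraicGarnierSolution (theta n m ε) (thetaInf M n m) U u (vEps n m ε u) :=
  ⟨h.isGarnierSolution hn hm hdvd hU ε, fun j => h.isAlgebraicOn j ε⟩

end

end Garnier

end

theorem theorem10 (M n m : ℕ) (hM : 0 < M) (hn : 0 < n) (hm : 1 < m) (hnm : Nat.Coprime n m)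
    (hdvd : m ∣ M + 2) :
    -- the polynomials `b_i` give a triangular solution of the Schlesinger system
    (Garnier.IsSchlesingerSolution (Garnier.config M) (Garnier.B M n m) ∧
      ∀ a, ∑ i, Garnier.B M n m i a =
        !![((M : ℂ) + 2) * n / (2 * m), 0; 0, -(((M : ℂ) + 2) * n / (2 * m))]) ∧
    -- near a generic point, the zeros of `P_M(z, a)` yield, for every choice of signs,
    -- an algebraic solution of the Garnier system
    (∃ D : MvPolynomial (Fin M) ℂ, D ≠ 0 ∧
      ∀ a₀ ∈ Garnier.config M, MvPolynomial.eval a₀ D ≠ 0 →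
        ∃ r > 0, ∃ u : (Fin M → ℂ) → Fin M → ℂ,
          Garnier.IsZeroBranch M n m (Metric.ball a₀ r) u ∧
          ∀ ε : Fin (M + 2) → ℤˣ,
            Garnier.IsAlgebraicGarnierSolution (Garnier.theta n m ε) (Garnier.thetaInf M n m)
              (Metric.ball a₀ r) u (Garnier.vEps n m ε u)) ∧
    -- and so does every branch of these zeros
    (∀ (U : Set (Fin M → ℂ)) (u : (Fin M → ℂ) → Fin M → ℂ), IsOpen U →
      Garnier.IsZeroBranch M n m U u →
      ∀ ε : Fin (M + 2) → ℤˣ,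
        Garnier.IsAlgebraicGarnierSolution (Garnier.theta n m ε) (Garnier.thetaInf M n m)
          U u (Garnier.vEps n m ε u)) := by
  refine ⟨⟨Garnier.isSchlesingerSolution_B hn hm hdvd, Garnier.sum_B hn hm hdvd⟩,
    ⟨Garnier.genericity M n m, Garnier.genericity_ne_zero hM hn hm hnm hdvd,
      fun a₀ ha₀ hD => ?_⟩,
    fun U u hU hu ε => hu.isAlgebraicGarnierSolution hn hm hdvd hU ε⟩
  obtain ⟨r, hr, u, hu⟩ := Garnier.exists_isZeroBranch hM hn hm hdvd ha₀ hD
  exact ⟨r, hr, u, hu, fun ε =>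
    hu.isAlgebraicGarnierSolution hn hm hdvd Metric.isOpen_ball ε⟩
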